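/- \textbf{Setting.} Fix a finite non-empty alphabet $\Sigma$ and let $\mathcal B=(\Sigma^*)^{\Sigma^*}$ be the set of all string functions. An oracle machine $M^?$ is a deterministic multi-tape Turing machine with an input tape, an output tape, an oracle query tape, an oracle answer tape and a special oracle state: with oracle $\varphi\in\mathcal B$, when it is in the oracle state with $\mathbf b$ written on the query tape, the content of the answer tape is replaced with $\varphi(\mathbf b)$ in one time step, without moving any head. $\mathrm{Time}_{M^?}(\varphi,\mathbf a)$ is the number of steps that $M^?$ takes with oracle $\varphi$ on input $\mathbf a$, and $M^\varphi(\mathbf a)$ is the string on the output tape after termination. The machine computes the partial operator $F_{M^?}\colon{\subseteq\mathcal B}\to\mathcal B$ whose domain consists of the $\varphi$ such that $M^\varphi$ is total, with $F_{M^?}(\varphi)=M^\varphi$. The second-order polynomials are the smallest class of maps $\mathbb N^{\mathbb N}\times\mathbb N\to\mathbb N$ that contains $(l,n)\mapsto p(n)$ for every $p\in\mathbb N[X]$, contains $(l,n)\mapsto l(P(l,n))$ whenever it contains $P$, and is closed under point-wise sums and products. A \emph{preparametrised space} $\mathbf X=(X,\xi_{\mathbf X},\mu_{\mathbf X})$ consists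 of a set $X$, a partial surjective map $\xi_{\mathbf X}\colon{\subseteq\mathcal B}\to X$ and a map $\mu_{\mathbf X}\colon\mathrm{dom}(\xi_{\mathbf X})\to\mathbb N^{\mathbb N}$ such that $\mu_{\mathbf X}(\varphi)$ is non-decreasing for every $\varphi\in\mathrm{dom}(\xi_{\mathbf X})$. A function $f\colon X\to Y$ between preparametrised spaces is \emph{computable in polynomial time} if there are an oracle machine $M^?$ and second-order polynomials $P$ and $Q$ such that \begin{itemize} \item $F_{M^?}$ is a realiser of $f$: for all $\varphi\in\mathrm{dom}(\xi_{\mathbf X})$, $\xi_{\mathbf Y}(F_{M^?}(\varphi))$ is defined and equals $f(\xi_{\mathbf X}(\varphi))$; \item $\mathrm{Time}_{M^?}(\varphi,\mathbf a)\le P(\mu_{\mathbf X}(\varphi),|\mathbf a|)$ for all $\varphi\in\mathrm{dom}(\xi_{\mathbf X})$ and $\mathbf a\in\Sigma^*$; \item $\mu_{\mathbf Y}(M^\varphi)(n)\le Q(\mu_{\mathbf X}(\varphi),n)$ for all $\varphi\in\mathrm{dom}(\xi_{\mathbf X})$ and $n\in\mathbb N$. \end{itemize} A \emph{parametrised space}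 is a preparametrised space whose identity function is computable in polynomial time. \textbf{Theorem (Composition).} Let $\mathbf X$, $\mathbf Y$ and $\mathbf Z$ be parametrised spaces. If $f\colon\mathbf X\to\mathbf Y$ and $g\colon\mathbf Y\to\mathbf Z$ are computable in polynomial time, then their composition $g\circ f\colon\mathbf X\to\mathbf Z$ is also computable in polynomial time. -/

import Mathlib

/-! ### Oracle Turing machines over a finite alphabet `A` -/

/-- Baire space: the string functions `A* → A*`. -/
abbrev StringFunctions (A : Type) : Type := List A → List A

/-- The tapes of an oracle machine: input, output, oracle query, oracle answer, and work tapes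
indexed by `K`. -/
inductive TapeName (K : Type) : Type
  | input
  | output
  | query
  | answer
  | work (k : K)

/-- Head movements. -/
inductive HeadMove : Type
  | left
  | stay
  | right

/-- The content of a cell: `none` is the blank, `some (Sum.inl s)` is a letter of the alphabet `A`,
and `some (Sum.inr g)` is an auxiliary tape symbol. -/
abbrev Cell (A G : Type) : Type := Option (A ⊕ G)

/-- A tape that is infinite to the right, with the position of its head. -/
structure OTape (A G : Type) : Type where
  cells : ℕ → Cell A G
  head : ℕ

namespace OTape

variable {A G : Type}

/-- The cells of a tape that carries the word `w` from cell `0` on and is blank elsewhere. -/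
def cellsOfWord (w : List A) : ℕ → Cell A G := fun n => (w[n]?).map Sum.inl

/-- The tape that carries the word `w`, with its head on the leftmost cell. -/
def ofWord (w : List A) : OTape A G := ⟨cellsOfWord w, 0⟩

/-- The symbol under the head. -/
def read (t : OTape A G) : Cell A G := t.cells t.head

/-- Write a symbol under the head and then move the head.  A head on the leftmost cell that is
asked to move left stays where it is. -/
def writeMove (t : OTape A G) (c : Cell A G) (m : HeadMove) : OTape A G where
  cells := Function.update t.cells t.head c
  head :=
    match m with
    | HeadMove.left => t.head - 1
    | HeadMove.stay => t.head
    | HeadMove.right => t.head + 1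

/-- Replace everything that is written on the tape by the word `w`; the head does not move. -/
def replaceBy (t : OTape A G) (w : List A) : OTape A G := ⟨cellsOfWord w, t.head⟩

/-- The letter in a cell, if the cell holds a letter of `A`. -/
def letter? : Cell A G → Option A
  | some (Sum.inl s) => some s
  | _ => none

/-- The first cell that does not hold a letter of `A`.  (All tapes that occur in a computation
have only finitely many non-blank cells, so there always is such a cell.) -/
noncomputable def wordLength (t : OTape A G) : ℕ := sInf {n | letter? (t.cells n) = none}

/-- The string that is written on the tape: the letters in the cells `0, 1, 2, …` up to the first
cell that does not hold a letter of `A`. -/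
noncomputable def content (t : OTape A G) : List A :=
  (List.range t.wordLength).filterMap fun n => letter? (t.cells n)

end OTape

/-- A (deterministic, multi-tape) oracle Turing machine over the alphabet `A`, with finitely many
states, work tapes and auxiliary tape symbols.  `ask` is the oracle state, and `resume` is the
state in which the machine continues after the oracle has answered. -/
structure OracleMachine (A : Type) : Type 1 where
  /-- states -/
  Q : Type
  /-- names of the work tapes -/
  K : Type
  /-- auxiliary tape symbols -/
  G : Type
  [finiteQ : Finite Q]
  [finiteK : Finite K]
  [finiteG : Finite G]
  start : Q
  halt : Q
  ask : Q
  resume : Q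
  /-- the transition function -/
  trans : Q → (TapeName K → Cell A G) → Q × (TapeName K → Cell A G × HeadMove)

namespace OracleMachine

variable {A : Type} (M : OracleMachine A)

/-- Configurations. -/
structure Cfg : Type where
  state : M.Q
  tapes : TapeName M.K → OTape A M.G

/-- The initial configuration on input `a`: all tapes but the input tape are blank. -/
def init (a : List A) : M.Cfg where
  state := M.start
  tapes := fun i =>
    match i with
    | TapeName.input => OTape.ofWord a
    | _ => OTape.ofWord []

/-- An ordinary step, according to the transition function. -/
def ordinaryStep (c : M.Cfg) : M.Cfg where
  state := (M.trans c.state fun i => (c.tapes i).read).1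
  tapes := fun i =>
    let r := (M.trans c.state fun j => (c.tapes j).read).2 i
    (c.tapes i).writeMove r.1 r.2

/-- An oracle call: the content of the answer tape is replaced by `φ b`, where `b` is the content
of the query tape.  No head moves and no other tape changes. -/
noncomputable def oracleStep (φ : StringFunctions A) (c : M.Cfg) : M.Cfg where
  state := M.resume
  tapes := fun i =>
    match i with
    | TapeName.answer =>
        (c.tapes TapeName.answer).replaceBy (φ (c.tapes TapeName.query).content)
    | j => c.tapes j

open Classical in
/-- One time step with oracle `φ`; a halted machine stays as it is. -/
noncomputable def step (φ : StringFunctions A) (c : M.Cfg) : M.Cfg :=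
  if c.state = M.halt then c
  else if c.state = M.ask then M.oracleStep φ c
  else M.ordinaryStep c

/-- The configuration after `n` time steps, with oracle `φ` and on input `a`. -/
noncomputable def run (φ : StringFunctions A) (a : List A) (n : ℕ) : M.Cfg :=
  (M.step φ)^[n] (M.init a)

/-- The machine has halted after at most `n` steps. -/
def HaltedAt (φ : StringFunctions A) (a : List A) (n : ℕ) : Prop :=
  (M.run φ a n).state = M.halt

/-- The number of steps that the machine takes with oracle `φ` and on input `a` (it is `⊤` if the
machine does not terminate). -/
noncomputable def time (φ : StringFunctions A) (a : List A) : ℕ∞ :=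
  ⨅ (n : ℕ) (_ : M.HaltedAt φ a n), (n : ℕ∞)

open Classical in
/-- The partial string function `M^φ`: the content of the output tape after termination. -/
noncomputable def eval (φ : StringFunctions A) : List A →. List A := fun a =>
  ⟨∃ n, M.HaltedAt φ a n, fun h => ((M.run φ a (Nat.find h)).tapes TapeName.output).content⟩

/-- The partial operator on Baire space that the machine computes.  Its domain consists of the
oracles `φ` for which `M^φ` is total, and it maps such a `φ` to `M^φ`. -/
noncomputable def operator : StringFunctions A →. StringFunctions A := fun φ =>
  ⟨∀ a, (M.eval φ a).Dom, fun h a => (M.eval φ a).get (h a)⟩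

end OracleMachine

/-! ### Second-order polynomials -/

/-- The class of second-order polynomials, as maps `(l, n) ↦ P(l, n)`. -/
inductive IsSecondOrderPolynomial : ((ℕ → ℕ) → ℕ → ℕ) → Prop
  | poly (p : Polynomial ℕ) : IsSecondOrderPolynomial fun _ n => p.eval n
  | app {P : (ℕ → ℕ) → ℕ → ℕ} (hP : IsSecondOrderPolynomial P) :
      IsSecondOrderPolynomial fun l n => l (P l n)
  | add {P Q : (ℕ → ℕ) → ℕ → ℕ} (hP : IsSecondOrderPolynomial P)
      (hQ : IsSecondOrderPolynomial Q) : IsSecondOrderPolynomial fun l n => P l n + Q l n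
  | mul {P Q : (ℕ → ℕ) → ℕ → ℕ} (hP : IsSecondOrderPolynomial P)
      (hQ : IsSecondOrderPolynomial Q) : IsSecondOrderPolynomial fun l n => P l n * Q l n

/-! ### Parametrised spaces -/

/-- A preparametrised space with underlying set `X`: a representation `ξ` of `X`, which is a
partial surjective map from Baire space to `X`, and a parameter `μ` for `ξ`, which is a map from
the domain of `ξ` to the non-decreasing functions `ℕ → ℕ`. -/
structure PreparametrisedSpace (A : Type) (X : Type*) where
  ξ : StringFunctions A →. X
  surjective : ∀ x : X, ∃ φ : StringFunctions A, x ∈ ξ φ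
  μ : ξ.Dom → ℕ → ℕ
  monotone : ∀ (φ : ξ.Dom) (n : ℕ), μ φ n ≤ μ φ (n + 1)

namespace PreparametrisedSpace

variable {A : Type} {X Y : Type*}

/-- `F` is a realiser of `f`: for every `φ` in the domain of `ξ_X`, the value `F(φ)` is defined,
lies in the domain of `ξ_Y`, and satisfies `ξ_Y(F(φ)) = f(ξ_X(φ))`. -/
def IsRealiser (SX : PreparametrisedSpace A X) (SY : PreparametrisedSpace A Y)
    (F : StringFunctions A →. StringFunctions A) (f : X → Y) : Prop :=
  ∀ φ : StringFunctions A, ∀ x ∈ SX.ξ φ, ∃ ψ ∈ F φ, f x ∈ SY.ξ ψ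

/-- `f` is computable in polynomial time: some oracle machine computes a realiser of `f`, with
running time and parameter blowup bounded by second-order polynomials `P` and `Q` in the
parameter. -/
def PolytimeComputable (SX : PreparametrisedSpace A X) (SY : PreparametrisedSpace A Y)
    (f : X → Y) : Prop :=
  ∃ (M : OracleMachine A) (P Q : (ℕ → ℕ) → ℕ → ℕ),
    IsSecondOrderPolynomial P ∧ IsSecondOrderPolynomial Q ∧
    IsRealiser SX SY M.operator f ∧
    (∀ (φ : SX.ξ.Dom) (a : List A), M.time φ.1 a ≤ (P (SX.μ φ) a.length : ℕ∞)) ∧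
    (∀ (φ : SX.ξ.Dom) (ψ : SY.ξ.Dom), ψ.1 ∈ M.operator φ.1 →
      ∀ n : ℕ, SY.μ ψ n ≤ Q (SX.μ φ) n)

/-- A preparametrised space is a parametrised space if its identity is computable in polynomial
time. -/
def IsParametrised (SX : PreparametrisedSpace A X) : Prop :=
  PolytimeComputable SX SX (id : X → X)

end PreparametrisedSpace

/-! Let `N` compute `f` and `M` compute `g`. The composite machine runs `M` and, whenever `M` asks
for the value at `b` of the function `ψ` that `N` computes from `φ`, runs `N` on `b` with the true
oracle `φ`. If `M` halts within `t` steps, its queries have length at most `t`, since a query is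
written one cell per step. Here `t` is bounded by `PM` at `μ_Y ψ ≤ QN (μ_X φ)`, and each run of `N`
by `B = PN (μ_X φ) t`. Second-order polynomials are monotone (`apply_mono`) and closed under
substitution in both arguments (`comp_right`, `comp_left`), so it suffices that the overhead of the
simulation is polynomial in `t` and `B`.

For every query words must be copied, tapes erased and heads rewound and put back. This is governed
by a clock tape whose number of marks grows with the simulated steps and bounds the region that has
to be treated; running along the clock is a loop of exactly that length (`reaches_rewind`,
`reaches_sweep`). Four such double sweeps handle one query (`reaches_suspended`, `reaches_resume`).

One tape escapes the clock: `φ` may return a word longer than any running time, so the true answer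
tape cannot be erased before `N` is started again with a supposedly blank answer tape. Each run of
`N` therefore uses a separate answer tape until its first oracle call, while the head of the true
answer tape makes the same moves. The call overwrites the stale word, and from then on the true tape
is used. The answers given to `M` cause no such trouble: `N` has written them itself, so the clock
bounds them. -/

/-! ### Tapes: relabelling, bounds on the used region, the word on a tape. -/

namespace OTape

variable {A G H : Type}

/-- Relabel the auxiliary symbols on a tape. -/
def map (e : G → H) (t : OTape A G) : OTape A H where
  cells n := (t.cells n).map (Sum.map id e)
  head := t.head

@[simp] theorem map_head (e : G → H) (t : OTape A G) : (t.map e).head = t.head := rfl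

theorem map_read (e : G → H) (t : OTape A G) :
    (t.map e).read = t.read.map (Sum.map id e) := rfl

theorem map_writeMove (e : G → H) (t : OTape A G) (c : Cell A G) (m : HeadMove) :
    (t.writeMove c m).map e = (t.map e).writeMove (c.map (Sum.map id e)) m := by
  simp only [map, writeMove, OTape.mk.injEq, and_true]
  funext n
  by_cases h : n = t.head
  · subst h; simp
  · simp [h]

theorem map_cellsOfWord (e : G → H) (w : List A) (n : ℕ) :
    (cellsOfWord w n : Cell A G).map (Sum.map id e) = cellsOfWord w n := by
  cases h : w[n]? <;> simp [cellsOfWord, h]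

theorem map_ofWord (e : G → H) (w : List A) : (ofWord w : OTape A G).map e = ofWord w := by
  simp only [map, ofWord, OTape.mk.injEq, and_true]
  exact funext (map_cellsOfWord e w)

theorem map_replaceBy (e : G → H) (t : OTape A G) (w : List A) :
    (t.replaceBy w).map e = (t.map e).replaceBy w := by
  simp only [map, replaceBy, OTape.mk.injEq, and_true]
  exact funext (map_cellsOfWord e w)

theorem letter?_map (e : G → H) (c : Cell A G) : letter? (c.map (Sum.map id e)) = letter? c := by
  rcases c with _ | (a | g) <;> rfl

theorem map_content (e : G → H) (t : OTape A G) : (t.map e).content = t.content := by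
  simp [content, wordLength, map, letter?_map]

@[simp] theorem writeMove_read_stay (t : OTape A G) : t.writeMove t.read HeadMove.stay = t := by
  simp [writeMove, read]

theorem writeMove_read_left (t : OTape A G) :
    t.writeMove t.read HeadMove.left = ⟨t.cells, t.head - 1⟩ := by
  simp [writeMove, read]

theorem writeMove_read_right (t : OTape A G) :
    t.writeMove t.read HeadMove.right = ⟨t.cells, t.head + 1⟩ := by
  simp [writeMove, read]

/-- The head and the non-blank cells lie within the first cells, up to cell `k`. -/
def Bounded (k : ℕ) (t : OTape A G) : Prop := t.head ≤ k ∧ ∀ n, k ≤ n → t.cells n = none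

theorem Bounded.mono {k l : ℕ} {t : OTape A G} (h : t.Bounded k) (hkl : k ≤ l) : t.Bounded l :=
  ⟨h.1.trans hkl, fun n hn => h.2 n (hkl.trans hn)⟩

theorem head_writeMove_le (t : OTape A G) (c : Cell A G) (m : HeadMove) :
    (t.writeMove c m).head ≤ t.head + 1 := by
  cases m <;> simp [writeMove]
  omega

theorem Bounded.writeMove {k : ℕ} {t : OTape A G} (h : t.Bounded k) (c : Cell A G)
    (m : HeadMove) : (t.writeMove c m).Bounded (k + 1) := by
  refine ⟨(head_writeMove_le t c m).trans (Nat.add_le_add_right h.1 1), fun n hn => ?_⟩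
  have h1 : n ≠ t.head := by have := h.1; omega
  simp [OTape.writeMove, h1, h.2 n (by omega)]

theorem Bounded.map {k : ℕ} {t : OTape A G} (h : t.Bounded k) (e : G → H) :
    (t.map e).Bounded k :=
  ⟨h.1, fun n hn => by simp [OTape.map, h.2 n hn]⟩

theorem bounded_ofWord {w : List A} {k : ℕ} (h : w.length ≤ k) :
    (ofWord w : OTape A G).Bounded k :=
  ⟨Nat.zero_le _, fun n hn => by simp [ofWord, cellsOfWord, h.trans hn]⟩

theorem Bounded.letter?_wordLength {k : ℕ} {t : OTape A G} (h : t.Bounded k) :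
    letter? (t.cells t.wordLength) = none :=
  Nat.sInf_mem (s := {n | letter? (t.cells n) = none}) ⟨k, by simp [h.2 k le_rfl, letter?]⟩

theorem Bounded.wordLength_le {k : ℕ} {t : OTape A G} (h : t.Bounded k) : t.wordLength ≤ k :=
  Nat.sInf_le (by simp [h.2 k le_rfl, letter?])

theorem letter?_of_lt_wordLength {t : OTape A G} {n : ℕ} (h : n < t.wordLength) :
    letter? (t.cells n) ≠ none :=
  Nat.notMem_of_lt_sInf h

theorem letter?_eq_some {c : Cell A G} {a : A} : letter? c = some a ↔ c = some (Sum.inl a) := by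
  rcases c with _ | (b | g) <;> simp [letter?]

/-- No entry is dropped, so positions in the filtered list are positions in the range. -/
theorem filterMap_range_eq {B : Type} (L : ℕ) (f : ℕ → Option B) (h : ∀ n < L, f n ≠ none) (n : ℕ) :
    ((List.range L).filterMap f)[n]? = if n < L then f n else none := by
  induction L generalizing n with
  | zero => simp
  | succ L ih =>
    have ih' := ih fun m hm => h m (by omega)
    have hlen : ((List.range L).filterMap f).length = L := by
      apply le_antisymm
      · simpa using List.length_filterMap_le f (List.range L)
      -- If the list were shorter than `L`, its entry just past the end would be both missing and a
      -- value of `f` below `L`.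
      · by_contra! hlt
        have h1 := ih' (((List.range L).filterMap f).length)
        rw [if_pos hlt] at h1
        simp only [lt_self_iff_false, not_false_eq_true, getElem?_neg] at h1
        exact h _ (by omega) h1.symm
    obtain ⟨a, ha⟩ := Option.ne_none_iff_exists'.1 (h L (by omega))
    rw [List.range_succ, List.filterMap_append, List.getElem?_append, hlen, ih']
    by_cases h1 : n < L
    · simp [h1, Nat.lt_succ_of_lt h1]
    · by_cases h2 : n = L
      · subst h2; simp [ha]
      · have h3 : ¬ n < L + 1 := by omega
        simp [h1, h3, ha]; omega

theorem getElem?_content (t : OTape A G) (n : ℕ) :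
    t.content[n]? = if n < t.wordLength then letter? (t.cells n) else none :=
  filterMap_range_eq _ _ (fun _ h => letter?_of_lt_wordLength h) n

/-- Copying cells up to the first non-letter thus yields a tape that carries exactly the content;
this justifies the copying loops. -/
theorem cellsOfWord_content (t : OTape A G) (n : ℕ) :
    cellsOfWord t.content n = if n < t.wordLength then t.cells n else none := by
  rw [cellsOfWord, getElem?_content]
  split_ifs with h
  · obtain ⟨a, ha⟩ := Option.ne_none_iff_exists'.1 (letter?_of_lt_wordLength h)
    rw [ha, letter?_eq_some.1 ha]; rfl
  · rfl

theorem length_content_le (t : OTape A G) : t.content.length ≤ t.wordLength :=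
  (List.length_filterMap_le _ _).trans_eq List.length_range

end OTape

/-! ### Halting times, values and operators of oracle machines. -/

namespace OracleMachine

variable {A : Type} (M : OracleMachine A)

theorem run_succ (φ : StringFunctions A) (a : List A) (n : ℕ) :
    M.run φ a (n + 1) = M.step φ (M.run φ a n) :=
  Function.iterate_succ_apply' _ _ _

theorem step_of_halt (φ : StringFunctions A) {c : M.Cfg} (h : c.state = M.halt) :
    M.step φ c = c := if_pos h

theorem run_eq_of_haltedAt {φ : StringFunctions A} {a : List A} {m n : ℕ}
    (h : M.HaltedAt φ a m) (hmn : m ≤ n) : M.run φ a n = M.run φ a m := by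
  induction n, hmn using Nat.le_induction with
  | base => rfl
  | succ n _ ih => rw [run_succ, ih, M.step_of_halt φ h]

theorem HaltedAt.mono {M : OracleMachine A} {φ : StringFunctions A} {a : List A} {m n : ℕ}
    (h : M.HaltedAt φ a m) (hmn : m ≤ n) : M.HaltedAt φ a n := by
  rw [HaltedAt, M.run_eq_of_haltedAt h hmn]; exact h

theorem time_le_of_haltedAt {φ : StringFunctions A} {a : List A} {n : ℕ}
    (h : M.HaltedAt φ a n) : M.time φ a ≤ n :=
  iInf₂_le n h

theorem haltedAt_of_time_le {φ : StringFunctions A} {a : List A} {n : ℕ}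
    (h : M.time φ a ≤ n) : M.HaltedAt φ a n := by
  -- A strict bound on the infimum produces an actual halting time below `n + 1`.
  have h1 : M.time φ a < ((n + 1 : ℕ) : ℕ∞) := h.trans_lt (by exact_mod_cast Nat.lt_succ_self n)
  simp only [time, iInf_lt_iff] at h1
  obtain ⟨m, hm, hlt⟩ := h1
  exact HaltedAt.mono hm (Nat.lt_succ_iff.1 (by exact_mod_cast hlt))

/-- Halted configurations are stationary, so any halting time may replace the least one. -/
theorem mem_eval_iff {φ : StringFunctions A} {a w : List A} :
    w ∈ M.eval φ a ↔
      ∃ n, M.HaltedAt φ a n ∧ ((M.run φ a n).tapes TapeName.output).content = w := by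
  classical
  constructor
  · rintro ⟨h, rfl⟩
    exact ⟨Nat.find h, Nat.find_spec h, by simp only [eval]⟩
  · rintro ⟨n, hn, rfl⟩
    refine ⟨⟨n, hn⟩, ?_⟩
    rw [M.run_eq_of_haltedAt (Nat.find_spec ⟨n, hn⟩) (Nat.find_min' _ hn)]
    simp only [eval]

theorem mem_operator_iff {φ ψ : StringFunctions A} :
    ψ ∈ M.operator φ ↔ ∀ a, ψ a ∈ M.eval φ a := by
  constructor
  · rintro ⟨h, rfl⟩ a
    exact Part.get_mem (h a)
  · intro h
    exact ⟨fun a => (h a).1, funext fun a => (h a).2⟩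

theorem output_content_of_haltedAt {φ ψ : StringFunctions A} (h : ψ ∈ M.operator φ)
    {a : List A} {n : ℕ} (hn : M.HaltedAt φ a n) :
    ((M.run φ a n).tapes TapeName.output).content = ψ a :=
  Part.mem_unique (M.mem_eval_iff.2 ⟨n, hn, rfl⟩) (M.mem_operator_iff.1 h a)

/-- The query tape is blank beyond the number of steps. -/
theorem bounded_run (φ : StringFunctions A) (a : List A) (n : ℕ) :
    ((M.run φ a n).tapes TapeName.query).Bounded n := by
  induction n with
  | zero => exact OTape.bounded_ofWord (le_refl 0)
  | succ n ih =>
    rw [run_succ, step]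
    split_ifs with h1 h2
    · exact ih.mono n.le_succ
    -- An oracle call leaves the query tape alone. The answer tape has no such bound, because a
    -- single step may fill it with an arbitrarily long word.
    · exact ih.mono n.le_succ
    · exact ih.writeMove _ _

end OracleMachine

/-! ### The composite machine -/

/-- Auxiliary symbols of a composite machine. -/
inductive CompSymbol (G₁ G₂ : Type) : Type
  | outer (g : G₁)
  | inner (g : G₂)
  | mark
  | bottom

/-- The four double sweeps over the tapes by which a composite machine handles a query of the
outer machine. -/
inductive Stage : Type
  | load
  | reset
  | unload
  | restore

/-- States of a composite machine. The flag of an `inner` state tells whether the inner machine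
has already asked the oracle. -/
inductive CompState (Q₁ Q₂ : Type) : Type
  | init
  | outer (q : Q₁)
  | rewind (p : Stage)
  | sweep (p : Stage)
  | inner (q : Q₂) (asked : Bool)
  | ask

/-- The tapes of a composite machine other than its clock: tapes that carry a mark for the head
positions on the query and answer tapes of the outer machine, the tape on which the true oracle
answers, and the tapes of both machines. -/
inductive Role (K₁ K₂ : Type) : Type
  | queryHead
  | answerHead
  | oracle
  | outer (i : TapeName K₁)
  | inner (i : TapeName K₂)

/-- The tapes whose heads are moved during the sweeps. -/
def Role.Mobile {K₁ K₂ : Type} : Role K₁ K₂ → Prop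
  | .outer .query => True
  | .outer .answer => True
  | .outer _ => False
  | _ => True

instance (K : Type) [Finite K] : Finite (TapeName K) :=
  Finite.of_surjective
    (fun x : Fin 4 ⊕ K => match x with
      | .inl 0 => .input | .inl 1 => .output | .inl 2 => .query | .inl 3 => .answer
      | .inr k => .work k)
    (by
      rintro (_ | _ | _ | _ | k)
      exacts [⟨.inl 0, rfl⟩, ⟨.inl 1, rfl⟩, ⟨.inl 2, rfl⟩, ⟨.inl 3, rfl⟩, ⟨.inr k, rfl⟩])

instance (G₁ G₂ : Type) [Finite G₁] [Finite G₂] : Finite (CompSymbol G₁ G₂) :=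
  Finite.of_surjective
    (fun x : (G₁ ⊕ G₂) ⊕ Bool => match x with
      | .inl (.inl g) => .outer g | .inl (.inr g) => .inner g
      | .inr true => .mark | .inr false => .bottom)
    (by
      rintro (g | g | _ | _)
      exacts [⟨.inl (.inl g), rfl⟩, ⟨.inl (.inr g), rfl⟩, ⟨.inr true, rfl⟩, ⟨.inr false, rfl⟩])

instance : Finite Stage :=
  Finite.of_surjective
    (fun x : Fin 4 => match x with
      | 0 => Stage.load | 1 => .reset | 2 => .unload | 3 => .restore)
    (by
      rintro (_ | _ | _ | _)
      exacts [⟨0, rfl⟩, ⟨1, rfl⟩, ⟨2, rfl⟩, ⟨3, rfl⟩])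

instance (Q₁ Q₂ : Type) [Finite Q₁] [Finite Q₂] : Finite (CompState Q₁ Q₂) :=
  Finite.of_surjective
    (fun x : (Q₁ ⊕ Stage ⊕ Stage) ⊕ (Q₂ × Bool) ⊕ Bool => match x with
      | .inl (.inl q) => .outer q | .inl (.inr (.inl p)) => .rewind p
      | .inl (.inr (.inr p)) => .sweep p | .inr (.inl q) => .inner q.1 q.2
      | .inr (.inr true) => .init | .inr (.inr false) => .ask)
    (by
      rintro (_ | q | p | p | ⟨q, b⟩ | _)
      exacts [⟨.inr (.inr true), rfl⟩, ⟨.inl (.inl q), rfl⟩, ⟨.inl (.inr (.inl p)), rfl⟩,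
        ⟨.inl (.inr (.inr p)), rfl⟩, ⟨.inr (.inl (q, b)), rfl⟩, ⟨.inr (.inr false), rfl⟩])

instance (K₁ K₂ : Type) [Finite K₁] [Finite K₂] : Finite (Role K₁ K₂) :=
  Finite.of_surjective
    (fun x : Fin 3 ⊕ TapeName K₁ ⊕ TapeName K₂ => match x with
      | .inl 0 => .queryHead | .inl 1 => .answerHead | .inl 2 => .oracle
      | .inr (.inl i) => .outer i | .inr (.inr i) => .inner i)
    (by
      rintro (_ | _ | _ | i | i)
      exacts [⟨.inl 0, rfl⟩, ⟨.inl 1, rfl⟩, ⟨.inl 2, rfl⟩, ⟨.inr (.inl i), rfl⟩,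
        ⟨.inr (.inr i), rfl⟩])

attribute [instance] OracleMachine.finiteQ OracleMachine.finiteK OracleMachine.finiteG

namespace OracleMachine

variable {A : Type}

section Transition

variable (M N : OracleMachine A)

/-- Cells of a composite machine. -/
abbrev CompCell : Type := Cell A (CompSymbol M.G N.G)

/-- Tapes of a composite machine. -/
abbrev CompTape : Type := OTape A (CompSymbol M.G N.G)

variable {M N}

/-- The content of a cell as it appears to the outer machine. -/
def outerCell : CompCell M N → Cell A M.G
  | some (Sum.inl a) => some (Sum.inl a)
  | some (Sum.inr (CompSymbol.outer g)) => some (Sum.inr g)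
  | _ => none

/-- The content of a cell as it appears to the inner machine. -/
def innerCell : CompCell M N → Cell A N.G
  | some (Sum.inl a) => some (Sum.inl a)
  | some (Sum.inr (CompSymbol.inner g)) => some (Sum.inr g)
  | _ => none

theorem outerCell_map (c : Cell A M.G) :
    outerCell (M := M) (N := N) (c.map (Sum.map id CompSymbol.outer)) = c := by
  rcases c with _ | (a | g) <;> rfl

theorem innerCell_map (c : Cell A N.G) :
    innerCell (M := M) (N := N) (c.map (Sum.map id CompSymbol.inner)) = c := by
  rcases c with _ | (a | g) <;> rfl

/-- The symbol that marks head positions and the ticks of the clock. -/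
def markCell : CompCell M N := some (Sum.inr CompSymbol.mark)

/-- The symbol on the leftmost cell of the clock. -/
def bottomCell : CompCell M N := some (Sum.inr CompSymbol.bottom)

/-- The actions on the tapes with given roles. -/
abbrev Action (M N : OracleMachine A) : Type := Role M.K N.K → CompCell M N × HeadMove

/-- Change nothing. -/
def idleAction (r : Role M.K N.K → CompCell M N) : Action M N := fun x => (r x, HeadMove.stay)

/-- Mark the heads on the query and answer tapes of the outer machine. -/
def markAction (r : Role M.K N.K → CompCell M N) : Action M N
  | .queryHead => (markCell, HeadMove.stay)
  | .answerHead => (markCell, HeadMove.stay)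
  | x => (r x, HeadMove.stay)

/-- Delete the marks for the heads on the query and answer tapes of the outer machine. -/
def unmarkAction (r : Role M.K N.K → CompCell M N) : Action M N
  | .queryHead => (none, HeadMove.stay)
  | .answerHead => (none, HeadMove.stay)
  | x => (r x, HeadMove.stay)

open Classical in
/-- Move heads to the left. -/
noncomputable def rewindAction (r : Role M.K N.K → CompCell M N) : Action M N :=
  fun x => (r x, if x.Mobile then HeadMove.left else HeadMove.stay)

open Classical in
/-- Move to the right unless the given cell carries a mark. -/
noncomputable def seekMove (c : CompCell M N) : HeadMove :=
  if c = markCell then HeadMove.stay else HeadMove.right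

/-- Move to the right unless the cell that is copied does not carry a letter. -/
def copyMove (c : CompCell M N) : HeadMove :=
  if (OTape.letter? c).isSome then HeadMove.right else HeadMove.stay

/-- The symbol to be written when the second cell is copied to the first one if it is a letter. -/
def copyCell (c d : CompCell M N) : CompCell M N :=
  if (OTape.letter? d).isSome then d else c

/-- The action in the loop from left to right. -/
noncomputable def sweepAction (r : Role M.K N.K → CompCell M N) : Stage → Action M N
  | .load, .outer .query => (r (.outer .query), copyMove (r (.outer .query)))
  | .load, .outer .answer => (none, HeadMove.right)
  | .load, .inner .input =>
      (copyCell (r (.inner .input)) (r (.outer .query)), copyMove (r (.outer .query)))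
  | .load, x => (r x, HeadMove.stay)
  | .reset, x => (r x, HeadMove.stay)
  | .unload, .inner .output => (r (.inner .output), copyMove (r (.inner .output)))
  | .unload, .outer .answer =>
      (copyCell (r (.outer .answer)) (r (.inner .output)), copyMove (r (.inner .output)))
  | .unload, x => (r x, HeadMove.stay)
  | .restore, .queryHead => (r .queryHead, seekMove (r .queryHead))
  | .restore, .outer .query => (r (.outer .query), seekMove (r .queryHead))
  | .restore, .answerHead => (r .answerHead, seekMove (r .answerHead))
  | .restore, .outer .answer => (r (.outer .answer), seekMove (r .answerHead))
  | .restore, .inner _ => (none, HeadMove.right)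
  | .restore, x => (r x, HeadMove.stay)

/-- Simulation of an ordinary step of the outer machine. -/
def outerAction (s : TapeName M.K → Cell A M.G × HeadMove) (r : Role M.K N.K → CompCell M N) :
    Action M N
  | .outer i => ((s i).1.map (Sum.map id CompSymbol.outer), (s i).2)
  | .queryHead => (r .queryHead, (s .query).2)
  | .answerHead => (r .answerHead, (s .answer).2)
  | x => (r x, HeadMove.stay)

/-- The tape on which the inner machine finds the oracle answers is blank until it has asked the
oracle. -/
def innerRole (asked : Bool) : TapeName N.K → Role M.K N.K
  | .answer => if asked then .oracle else .inner .answer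
  | i => .inner i

/-- Simulation of an ordinary step of the inner machine. -/
def innerAction (s : TapeName N.K → Cell A N.G × HeadMove) (asked : Bool)
    (r : Role M.K N.K → CompCell M N) : Action M N
  | .inner .answer =>
      if asked then (r (.inner .answer), HeadMove.stay)
      else ((s .answer).1.map (Sum.map id CompSymbol.inner), (s .answer).2)
  | .inner i => ((s i).1.map (Sum.map id CompSymbol.inner), (s i).2)
  | .oracle =>
      (if asked then (s .answer).1.map (Sum.map id CompSymbol.inner) else r .oracle, (s .answer).2)
  | x => (r x, HeadMove.stay)

variable (M N)

open Classical in
/-- The transition function of a composite machine: the new state, the action on the clock, and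
the actions on all other tapes. -/
noncomputable def compTrans (q : CompState M.Q N.Q) (c : CompCell M N)
    (r : Role M.K N.K → CompCell M N) :
    CompState M.Q N.Q × (CompCell M N × HeadMove) × Action M N :=
  match q with
  | .init => (.outer M.start, (bottomCell, HeadMove.right), idleAction r)
  | .outer q =>
      if q = M.ask then (.rewind .load, (markCell, HeadMove.stay), markAction r)
      else
        let s := M.trans q fun i => outerCell (r (.outer i))
        (.outer s.1, (markCell, HeadMove.right), outerAction s.2 r)
  | .rewind p =>
      if c = bottomCell then (.sweep p, (c, HeadMove.right), idleAction r)
      else (.rewind p, (c, HeadMove.left), rewindAction r)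
  | .sweep p =>
      if c = none then
        match p with
        | .load => (.rewind .reset, (c, HeadMove.left), idleAction r)
        | .reset => (.inner N.start false, (c, HeadMove.stay), idleAction r)
        | .unload => (.rewind .restore, (c, HeadMove.left), idleAction r)
        | .restore => (.outer M.resume, (c, HeadMove.stay), unmarkAction r)
      else (.sweep p, (c, HeadMove.right), sweepAction r p)
  | .inner q asked =>
      if q = N.halt then (.rewind .unload, (c, HeadMove.left), idleAction r)
      else if q = N.ask then (.ask, (markCell, HeadMove.right), idleAction r)
      else
        let s := N.trans q fun i => innerCell (r (innerRole asked i))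
        (.inner s.1 asked, (markCell, HeadMove.right), innerAction s.2 asked r)
  | .ask => (.ask, (c, HeadMove.stay), idleAction r)

/-! ### Assigning roles to tapes, and steps in terms of roles. -/

/-- The tape of the composite machine with a given role, or the clock. -/
def tapeOfRole : Option (Role M.K N.K) → TapeName (Option (Role M.K N.K))
  | some (.outer .input) => .input
  | some (.outer .output) => .output
  | some (.inner .query) => .query
  | some .oracle => .answer
  | x => .work x

/-- The role of a tape of the composite machine. -/
def roleOfTape : TapeName (Option (Role M.K N.K)) → Option (Role M.K N.K)
  | .input => some (.outer .input)
  | .output => some (.outer .output)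
  | .query => some (.inner .query)
  | .answer => some .oracle
  | .work x => x

/-- Only a one-sided inverse: a work tape whose role is taken by one of the four special tapes
imitates that role, but is never read. -/
theorem roleOfTape_tapeOfRole (x : Option (Role M.K N.K)) :
    roleOfTape M N (tapeOfRole M N x) = x := by
  rcases x with _ | _ | _ | _ | (_ | _ | _ | _ | _) | (_ | _ | _ | _ | _) <;> rfl

/-- The composite machine, which runs `M` and answers its queries by running `N`. -/
noncomputable def comp : OracleMachine A where
  Q := CompState M.Q N.Q
  K := Option (Role M.K N.K)
  G := CompSymbol M.G N.G
  start := .init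
  halt := .outer M.halt
  ask := .ask
  resume := .inner N.resume true
  trans q r :=
    let s := compTrans M N q (r (tapeOfRole M N none)) fun x => r (tapeOfRole M N (some x))
    (s.1, fun i => ((roleOfTape M N i).elim s.2.1 s.2.2))

/-- A configuration of the composite machine, with the tapes given by their roles. -/
@[ext]
structure View : Type where
  state : CompState M.Q N.Q
  clock : CompTape M N
  tapes : Role M.K N.K → CompTape M N

variable {M N}

/-- The view of a configuration. -/
def view (c : (M.comp N).Cfg) : View M N where
  state := c.state
  clock := c.tapes (tapeOfRole M N none)
  tapes x := c.tapes (tapeOfRole M N (some x))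

/-- Replace the content of the tape on which the oracle answers. -/
def answerOracle (S : Role M.K N.K → CompTape M N) (w : List A) : Role M.K N.K → CompTape M N
  | .oracle => (S .oracle).replaceBy w
  | x => S x

open Classical in
/-- One time step in terms of views. -/
noncomputable def viewStep (φ : StringFunctions A) (v : View M N) : View M N :=
  if v.state = .outer M.halt then v
  else if v.state = .ask then
    ⟨.inner N.resume true, v.clock, answerOracle v.tapes (φ (v.tapes (.inner .query)).content)⟩
  else
    let s := compTrans M N v.state v.clock.read fun x => (v.tapes x).read
    ⟨s.1, v.clock.writeMove s.2.1.1 s.2.1.2,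
      fun x => (v.tapes x).writeMove (s.2.2 x).1 (s.2.2 x).2⟩

theorem view_step (φ : StringFunctions A) (c : (M.comp N).Cfg) :
    view ((M.comp N).step φ c) = viewStep φ (view c) := by
  unfold step viewStep
  by_cases h1 : c.state = (M.comp N).halt
  · have h1' : (view c).state = .outer M.halt := h1
    rw [if_pos h1, if_pos h1']
  · have h1' : ¬ (view c).state = .outer M.halt := h1
    rw [if_neg h1, if_neg h1']
    by_cases h2 : c.state = (M.comp N).ask
    · have h2' : (view c).state = .ask := h2
      rw [if_pos h2, if_pos h2']
      refine View.ext rfl rfl (funext fun x => ?_)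
      rcases x with _ | _ | _ | (_ | _ | _ | _ | _) | (_ | _ | _ | _ | _) <;> rfl
    · have h2' : ¬ (view c).state = .ask := h2
      rw [if_neg h2, if_neg h2']
      refine View.ext rfl rfl (funext fun x => ?_)
      simp only [view, ordinaryStep, comp, roleOfTape_tapeOfRole, Option.elim]

/-- The composite machine gets from the view `v` to the view `w` in `n` steps. -/
def Reaches (φ : StringFunctions A) (n : ℕ) (v w : View M N) : Prop :=
  (viewStep φ)^[n] v = w

theorem Reaches.trans {φ : StringFunctions A} {m n : ℕ} {u v w : View M N}
    (h : Reaches φ m u v) (h' : Reaches φ n v w) : Reaches φ (m + n) u w := by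
  rw [Reaches, Nat.add_comm, Function.iterate_add_apply]
  rw [Reaches] at h h'
  rw [h, h']

theorem view_iterate {φ : StringFunctions A} {n : ℕ} {c : (M.comp N).Cfg} {w : View M N}
    (h : Reaches φ n (view c) w) : view (((M.comp N).step φ)^[n] c) = w := by
  rw [← h]
  exact Function.Semiconj.iterate_right (view_step φ) n c

/-- An ordinary step in terms of views. -/
theorem reaches_one {φ : StringFunctions A} {q : CompState M.Q N.Q} {c : CompTape M N}
    {S : Role M.K N.K → CompTape M N} {q' : CompState M.Q N.Q} {d : CompCell M N × HeadMove}
    {s : Action M N} (h₁ : q ≠ .outer M.halt) (h₂ : q ≠ .ask)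
    (h : compTrans M N q c.read (fun x => (S x).read) = (q', d, s)) :
    Reaches φ 1 ⟨q, c, S⟩ ⟨q', c.writeMove d.1 d.2, fun x => (S x).writeMove (s x).1 (s x).2⟩ := by
  rw [Reaches, Function.iterate_one, viewStep, if_neg h₁, if_neg h₂]
  simp only [h]

theorem reaches_ask {φ : StringFunctions A} {c : CompTape M N}
    {S : Role M.K N.K → CompTape M N} :
    Reaches φ 1 ⟨.ask, c, S⟩ ⟨.inner N.resume true, c, answerOracle S (φ (S (.inner .query)).content)⟩ := by
  simp [Reaches, viewStep]

end Transition

end OracleMachine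

/-! ### The clock and the loops that it controls. -/

namespace OracleMachine

variable {A : Type} {M N : OracleMachine A}

/-- A clock that shows the number `k`. -/
def clockTape (k pos : ℕ) : CompTape M N where
  cells n := if n = 0 then bottomCell else if n ≤ k then markCell else none
  head := pos

theorem clockTape_read_zero (k : ℕ) : (clockTape k 0 : CompTape M N).read = bottomCell := rfl

theorem clockTape_read_mark {k pos : ℕ} (h₀ : pos ≠ 0) (h : pos ≤ k) :
    (clockTape k pos : CompTape M N).read = markCell := by
  simp [clockTape, OTape.read, h₀, h]

theorem clockTape_read_end (k : ℕ) : (clockTape k (k + 1) : CompTape M N).read = none := by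
  simp [clockTape, OTape.read]

theorem clockTape_left (k pos : ℕ) :
    (clockTape k (pos + 1) : CompTape M N).writeMove (clockTape k (pos + 1)).read HeadMove.left =
      clockTape k pos := by
  rw [OTape.writeMove_read_left]; rfl

theorem clockTape_right (k pos : ℕ) :
    (clockTape k pos : CompTape M N).writeMove (clockTape k pos).read HeadMove.right =
      clockTape k (pos + 1) := by
  rw [OTape.writeMove_read_right]; rfl

theorem clockTape_tick_stay (k : ℕ) :
    (clockTape k (k + 1) : CompTape M N).writeMove markCell HeadMove.stay =
      clockTape (k + 1) (k + 1) := by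
  simp only [clockTape, OTape.writeMove, OTape.mk.injEq, and_true]
  funext n
  rcases lt_trichotomy n (k + 1) with h | rfl | h
  · simp [h.ne, Nat.lt_succ_iff.1 h, h.le]
  · simp
  · simp [h.ne', h.not_ge, show ¬ n ≤ k by omega]

theorem clockTape_tick_right (k : ℕ) :
    (clockTape k (k + 1) : CompTape M N).writeMove markCell HeadMove.right =
      clockTape (k + 1) (k + 2) := by
  have h := clockTape_tick_stay (M := M) (N := N) k
  simp only [clockTape, OTape.writeMove, OTape.mk.injEq, and_true] at h ⊢
  exact h

theorem clockTape_init :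
    (OTape.ofWord [] : CompTape M N).writeMove bottomCell HeadMove.right = clockTape 0 1 := by
  simp only [clockTape, OTape.writeMove, OTape.mk.injEq, OTape.ofWord, and_true]
  funext n
  by_cases h : n = 0 <;> simp [h, OTape.cellsOfWord]

theorem writeMove_idle (S : Role M.K N.K → CompTape M N) :
    (fun x => (S x).writeMove (idleAction (fun y => (S y).read) x).1
      (idleAction (fun y => (S y).read) x).2) = S :=
  funext fun x => (S x).writeMove_read_stay

/-- The tapes after `k` moves to the left. -/
noncomputable def rewound (k : ℕ) (S : Role M.K N.K → CompTape M N) (x : Role M.K N.K) : CompTape M N :=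
  ⟨(S x).cells, open Classical in if x.Mobile then (S x).head - k else (S x).head⟩

/-- Heads that arrive early wait at cell `0`, as truncated subtraction expresses; no position has to
be known exactly. -/
theorem rewound_of_mobile {k : ℕ} {S : Role M.K N.K → CompTape M N} {x : Role M.K N.K}
    (h : x.Mobile) (hk : (S x).head ≤ k) : rewound k S x = ⟨(S x).cells, 0⟩ := by
  simp [rewound, h, hk]

theorem rewound_of_not_mobile {k : ℕ} {S : Role M.K N.K → CompTape M N} {x : Role M.K N.K}
    (h : ¬ x.Mobile) : rewound k S x = S x := by
  simp [rewound, h]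

theorem writeMove_rewindAction (j : ℕ) (S : Role M.K N.K → CompTape M N) :
    (fun x => (rewound j S x).writeMove (rewindAction (fun y => (rewound j S y).read) x).1
      (rewindAction (fun y => (rewound j S y).read) x).2) = rewound (j + 1) S := by
  funext x
  by_cases h : x.Mobile
  · simp only [rewindAction, if_pos h, OTape.writeMove_read_left]
    simp [rewound, h, Nat.sub_sub]
  · simp only [rewindAction, if_neg h, OTape.writeMove_read_stay]
    simp [rewound, h]

variable {φ : StringFunctions A}

/-- The `k` moves to the left are followed by one step at the bottom symbol, which sends the clock
head to the first mark. -/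
theorem reaches_rewind (p : Stage) (k : ℕ) (S : Role M.K N.K → CompTape M N) :
    Reaches φ (k + 1) ⟨.rewind p, clockTape k k, S⟩ ⟨.sweep p, clockTape k 1, rewound k S⟩ := by
  have key : ∀ j i, i + j = k →
      Reaches φ j ⟨.rewind p, clockTape k k, S⟩ ⟨.rewind p, clockTape k i, rewound j S⟩ := by
    intro j
    induction j with
    | zero =>
      rintro i rfl
      have h : rewound 0 S = S := funext fun x => by simp [rewound]
      rw [Nat.add_zero, h]; rfl
    | succ j ih =>
      intro i hi
      refine (ih (i + 1) (by omega)).trans ?_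
      have h := reaches_one (φ := φ) (M := M) (N := N) (q := .rewind p)
        (c := clockTape k (i + 1)) (S := rewound j S)
        (q' := .rewind p) (d := ((clockTape k (i + 1)).read, HeadMove.left))
        (s := rewindAction fun y => (rewound j S y).read) (by simp) (by simp)
        (by
          rw [clockTape_read_mark (by omega) (by omega)]
          simp [compTrans, markCell, bottomCell])
      rwa [clockTape_left, writeMove_rewindAction] at h
  refine (key k 0 (by omega)).trans ?_
  have h := reaches_one (φ := φ) (M := M) (N := N) (q := .rewind p)
    (c := clockTape k 0) (S := rewound k S)
    (q' := .sweep p) (d := ((clockTape k 0).read, HeadMove.right))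
    (s := idleAction fun y => (rewound k S y).read) (by simp) (by simp)
    (by simp [compTrans, clockTape_read_zero])
  rwa [clockTape_right, writeMove_idle] at h

/-- A loop rule: the family `T` describes the tapes after `j` rounds, and the marks of the clock
count the rounds. -/
theorem reaches_sweep (p : Stage) (k : ℕ) (T : ℕ → Role M.K N.K → CompTape M N)
    (hT : ∀ j x, (T j x).writeMove (sweepAction (fun y => (T j y).read) p x).1
      (sweepAction (fun y => (T j y).read) p x).2 = T (j + 1) x) :
    Reaches φ k ⟨.sweep p, clockTape k 1, T 0⟩ ⟨.sweep p, clockTape k (k + 1), T k⟩ := by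
  have key : ∀ j, j ≤ k →
      Reaches φ j ⟨.sweep p, clockTape k 1, T 0⟩ ⟨.sweep p, clockTape k (j + 1), T j⟩ := by
    intro j
    induction j with
    | zero => intro _; rfl
    | succ j ih =>
      intro hj
      refine (ih (by omega)).trans ?_
      have h := reaches_one (φ := φ) (M := M) (N := N) (q := .sweep p)
        (c := clockTape k (j + 1)) (S := T j)
        (q' := .sweep p) (d := ((clockTape k (j + 1)).read, HeadMove.right))
        (s := sweepAction (fun y => (T j y).read) p) (by simp) (by simp)
        (by
          rw [clockTape_read_mark (by omega) (by omega)]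
          simp [compTrans, markCell])
      rwa [clockTape_right, funext (hT j)] at h
  exact key k le_rfl

/-! #### Sweeps on single tapes -/

/-- The head stops at the first non-letter and idles there, so it is at `min j L` after `j` rounds
even if the loop runs on. -/
theorem writeMove_copy_source {c : ℕ → CompCell M N} {L : ℕ}
    (hL : OTape.letter? (c L) = none) (h : ∀ n < L, OTape.letter? (c n) ≠ none) (j : ℕ) :
    (⟨c, min j L⟩ : CompTape M N).writeMove (c (min j L)) (copyMove (c (min j L))) =
      ⟨c, min (j + 1) L⟩ := by
  rcases lt_or_ge j L with hj | hj
  · have h1 : (OTape.letter? (c j)).isSome := Option.isSome_iff_ne_none.2 (h j hj)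
    have h2 : min (j + 1) L = j + 1 := min_eq_left hj
    simp [OTape.writeMove, copyMove, min_eq_left hj.le, h1, h2]
  · have h2 : min (j + 1) L = L := min_eq_right (by omega)
    simp [OTape.writeMove, copyMove, min_eq_right hj, hL, h2]

/-- A tape that carries the first cells of `c`. -/
def prefixTape (c : ℕ → CompCell M N) (n : ℕ) : CompTape M N :=
  ⟨fun m => if m < n then c m else none, n⟩

/-- The source cell controls both heads, so they move in lockstep and the copy stops without a
copied delimiter. -/
theorem writeMove_copy_target {c : ℕ → CompCell M N} {L : ℕ}
    (hL : OTape.letter? (c L) = none) (h : ∀ n < L, OTape.letter? (c n) ≠ none) (j : ℕ) :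
    (prefixTape c (min j L)).writeMove (copyCell (prefixTape c (min j L)).read (c (min j L)))
      (copyMove (c (min j L))) = prefixTape c (min (j + 1) L) := by
  rcases lt_or_ge j L with hj | hj
  · have h1 : (OTape.letter? (c j)).isSome := Option.isSome_iff_ne_none.2 (h j hj)
    have h2 : min (j + 1) L = j + 1 := min_eq_left hj
    simp only [prefixTape, OTape.writeMove, copyMove, copyCell, min_eq_left hj.le, h1, h2, if_true,
      OTape.mk.injEq, and_true]
    funext m
    rcases lt_trichotomy m j with hm | rfl | hm
    · simp [hm.ne, hm, Nat.lt_succ_of_lt hm]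
    · simp
    · simp [hm.ne', hm.not_gt, show ¬ m < j + 1 by omega]
  · have h2 : min (j + 1) L = L := min_eq_right (by omega)
    simp [OTape.writeMove, copyMove, copyCell, min_eq_right hj, hL, h2, OTape.read, prefixTape]

/-- A tape the first cells of which have been erased. -/
def erasedTape (c : ℕ → CompCell M N) (n : ℕ) : CompTape M N :=
  ⟨fun m => if m < n then none else c m, n⟩

theorem writeMove_erasedTape (c : ℕ → CompCell M N) (j : ℕ) :
    (erasedTape c j).writeMove none HeadMove.right = erasedTape c (j + 1) := by
  simp only [erasedTape, OTape.writeMove, OTape.mk.injEq, and_true]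
  funext m
  rcases lt_trichotomy m j with hm | rfl | hm
  · simp [hm.ne, hm, Nat.lt_succ_of_lt hm]
  · simp
  · simp [hm.ne', hm.not_gt, show ¬ m < j + 1 by omega]

theorem erasedTape_of_blank {c : ℕ → CompCell M N} {k : ℕ} (h : ∀ n, k ≤ n → c n = none) :
    erasedTape c k = ⟨fun _ => none, k⟩ := by
  simp only [erasedTape, OTape.mk.injEq, and_true]
  funext m
  split_ifs with hm
  · rfl
  · exact h m (not_lt.1 hm)

/-- The cells of a tape with one mark. -/
def markCells (h : ℕ) : ℕ → CompCell M N := fun n => if n = h then markCell else none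

/-- The mark lies on a second tape whose head moves in parallel; the tape `c` itself cannot carry it
without losing a symbol. -/
theorem writeMove_seek (c : ℕ → CompCell M N) (h j : ℕ) :
    (⟨c, min j h⟩ : CompTape M N).writeMove (c (min j h))
      (seekMove (markCells (M := M) (N := N) h (min j h))) = ⟨c, min (j + 1) h⟩ := by
  rcases lt_or_ge j h with hj | hj
  · have h2 : min (j + 1) h = j + 1 := min_eq_left hj
    simp [OTape.writeMove, seekMove, markCells, min_eq_left hj.le, h2, hj.ne, markCell]
  · have h2 : min (j + 1) h = h := min_eq_right (by omega)
    simp [OTape.writeMove, seekMove, markCells, min_eq_right hj, h2]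

/-! #### The sweeps -/

/-- The tapes in the sweep that loads the query of the outer machine. -/
noncomputable def loaded (S : Role M.K N.K → CompTape M N) (j : ℕ) : Role M.K N.K → CompTape M N
  | .outer .query => ⟨(S (.outer .query)).cells, min j (S (.outer .query)).wordLength⟩
  | .outer .answer => erasedTape (S (.outer .answer)).cells j
  | .inner .input => prefixTape (S (.outer .query)).cells (min j (S (.outer .query)).wordLength)
  | x => S x

theorem reaches_load {k l : ℕ} {S : Role M.K N.K → CompTape M N}
    (hq : (S (.outer .query)).head = 0) (hb : (S (.outer .query)).Bounded l)
    (ha : (S (.outer .answer)).head = 0)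
    (hi : S (.inner .input) = ⟨fun _ => none, 0⟩) :
    Reaches φ (k + 1) ⟨.sweep .load, clockTape k 1, S⟩
      ⟨.rewind .reset, clockTape k k, loaded S k⟩ := by
  have h0 : loaded S 0 = S := by
    funext x
    rcases x with _ | _ | _ | (_ | _ | _ | _ | _) | (_ | _ | _ | _ | _) <;>
      simp [loaded, erasedTape, prefixTape, hi]
    · rw [← hq]
    · rw [← ha]
  have h1 := reaches_sweep (φ := φ) .load k (loaded S) (by
    intro j x
    rcases x with _ | _ | _ | (_ | _ | _ | _ | _) | (_ | _ | _ | _ | _) <;>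
      try exact OTape.writeMove_read_stay _
    -- Boundedness ensures that there is a non-letter; otherwise `wordLength` would be the default
    -- value `sInf ∅ = 0`.
    · exact writeMove_copy_source hb.letter?_wordLength
        (fun n => OTape.letter?_of_lt_wordLength) j
    · exact writeMove_erasedTape _ j
    · exact writeMove_copy_target hb.letter?_wordLength
        (fun n => OTape.letter?_of_lt_wordLength) j)
  rw [h0] at h1
  refine h1.trans ?_
  have h := reaches_one (φ := φ) (M := M) (N := N) (q := .sweep .load)
    (c := clockTape k (k + 1)) (S := loaded S k)
    (q' := .rewind .reset) (d := ((clockTape k (k + 1)).read, HeadMove.left))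
    (s := idleAction fun y => (loaded S k y).read) (by simp) (by simp)
    (by simp [compTrans, clockTape_read_end])
  rwa [clockTape_left, writeMove_idle] at h

/-- The preceding rewind has done the real work. This sweep only returns the clock head to the first
blank cell, where simulated steps add their marks. -/
theorem reaches_reset {k : ℕ} {S : Role M.K N.K → CompTape M N} :
    Reaches φ (k + 1) ⟨.sweep .reset, clockTape k 1, S⟩
      ⟨.inner N.start false, clockTape k (k + 1), S⟩ := by
  refine (reaches_sweep (φ := φ) .reset k (fun _ => S)
    (fun j x => OTape.writeMove_read_stay _)).trans ?_
  have h := reaches_one (φ := φ) (M := M) (N := N) (q := .sweep .reset)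
    (c := clockTape k (k + 1)) (S := S)
    (q' := .inner N.start false) (d := ((clockTape k (k + 1)).read, HeadMove.stay))
    (s := idleAction fun y => (S y).read) (by simp) (by simp)
    (by simp [compTrans, clockTape_read_end])
  rwa [OTape.writeMove_read_stay, writeMove_idle] at h

/-- The tapes in the sweep that copies the output of the inner machine. -/
noncomputable def unloaded (S : Role M.K N.K → CompTape M N) (j : ℕ) :
    Role M.K N.K → CompTape M N
  | .inner .output => ⟨(S (.inner .output)).cells, min j (S (.inner .output)).wordLength⟩
  | .outer .answer =>
      prefixTape (S (.inner .output)).cells (min j (S (.inner .output)).wordLength)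
  | x => S x

theorem reaches_unload {k l : ℕ} {S : Role M.K N.K → CompTape M N}
    (ho : (S (.inner .output)).head = 0) (hb : (S (.inner .output)).Bounded l)
    (ha : S (.outer .answer) = ⟨fun _ => none, 0⟩) :
    Reaches φ (k + 1) ⟨.sweep .unload, clockTape k 1, S⟩
      ⟨.rewind .restore, clockTape k k, unloaded S k⟩ := by
  have h0 : unloaded S 0 = S := by
    funext x
    rcases x with _ | _ | _ | (_ | _ | _ | _ | _) | (_ | _ | _ | _ | _) <;>
      simp [unloaded, prefixTape, ha]
    rw [← ho]
  have h1 := reaches_sweep (φ := φ) .unload k (unloaded S) (by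
    intro j x
    rcases x with _ | _ | _ | (_ | _ | _ | _ | _) | (_ | _ | _ | _ | _) <;>
      try exact OTape.writeMove_read_stay _
    · exact writeMove_copy_target hb.letter?_wordLength
        (fun n => OTape.letter?_of_lt_wordLength) j
    · exact writeMove_copy_source hb.letter?_wordLength
        (fun n => OTape.letter?_of_lt_wordLength) j)
  rw [h0] at h1
  refine h1.trans ?_
  have h := reaches_one (φ := φ) (M := M) (N := N) (q := .sweep .unload)
    (c := clockTape k (k + 1)) (S := unloaded S k)
    (q' := .rewind .restore) (d := ((clockTape k (k + 1)).read, HeadMove.left))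
    (s := idleAction fun y => (unloaded S k y).read) (by simp) (by simp)
    (by simp [compTrans, clockTape_read_end])
  rwa [clockTape_left, writeMove_idle] at h

/-- The tapes in the sweep that restores the heads of the outer machine, which were at `h₁` and
`h₂`, and erases the tapes of the inner machine. -/
def restored (S : Role M.K N.K → CompTape M N) (h₁ h₂ j : ℕ) : Role M.K N.K → CompTape M N
  | .queryHead => ⟨markCells h₁, min j h₁⟩
  | .answerHead => ⟨markCells h₂, min j h₂⟩
  | .outer .query => ⟨(S (.outer .query)).cells, min j h₁⟩
  | .outer .answer => ⟨(S (.outer .answer)).cells, min j h₂⟩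
  | .inner i => erasedTape (S (.inner i)).cells j
  | x => S x

/-- The tapes after the marks have been deleted. -/
def unmarked (S : Role M.K N.K → CompTape M N) (h₁ h₂ j : ℕ) : Role M.K N.K → CompTape M N
  | .queryHead => ⟨fun _ => none, h₁⟩
  | .answerHead => ⟨fun _ => none, h₂⟩
  | x => restored S h₁ h₂ j x

theorem update_markCells (h : ℕ) :
    Function.update (markCells (M := M) (N := N) h) h none = fun _ => none := by
  funext n
  by_cases hn : n = h <;> simp [hn, markCells]

theorem reaches_restore {k h₁ h₂ : ℕ} {S : Role M.K N.K → CompTape M N}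
    (hk₁ : h₁ ≤ k) (hk₂ : h₂ ≤ k)
    (hq : S .queryHead = ⟨markCells h₁, 0⟩) (ha : S .answerHead = ⟨markCells h₂, 0⟩)
    (hq' : (S (.outer .query)).head = 0) (ha' : (S (.outer .answer)).head = 0)
    (hi : ∀ i, (S (.inner i)).head = 0) :
    Reaches φ (k + 1) ⟨.sweep .restore, clockTape k 1, S⟩
      ⟨.outer M.resume, clockTape k (k + 1), unmarked S h₁ h₂ k⟩ := by
  have h0 : restored S h₁ h₂ 0 = S := by
    funext x
    rcases x with _ | _ | _ | (_ | _ | _ | _ | _) | i <;>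
      simp [restored, erasedTape, hq, ha]
    · rw [← hq']
    · rw [← ha']
    · rw [← hi i]
  have h1 := reaches_sweep (φ := φ) .restore k (restored S h₁ h₂) (by
    intro j x
    rcases x with _ | _ | _ | (_ | _ | _ | _ | _) | i <;>
      try exact OTape.writeMove_read_stay _
    · exact writeMove_seek _ h₁ j
    · exact writeMove_seek _ h₂ j
    · exact writeMove_seek _ h₁ j
    · exact writeMove_seek _ h₂ j
    · exact writeMove_erasedTape _ j)
  rw [h0] at h1
  refine h1.trans ?_
  have h := reaches_one (φ := φ) (M := M) (N := N) (q := .sweep .restore)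
    (c := clockTape k (k + 1)) (S := restored S h₁ h₂ k)
    (q' := .outer M.resume) (d := ((clockTape k (k + 1)).read, HeadMove.stay))
    (s := unmarkAction fun y => (restored S h₁ h₂ k y).read) (by simp) (by simp)
    (by simp [compTrans, clockTape_read_end])
  rw [OTape.writeMove_read_stay] at h
  convert h using 2
  funext x
  rcases x with _ | _ | _ | (_ | _ | _ | _ | _) | i <;>
    try exact (OTape.writeMove_read_stay _).symm
  · simp [unmarked, unmarkAction, restored, OTape.writeMove, hk₁, update_markCells]
  · simp [unmarked, unmarkAction, restored, OTape.writeMove, hk₂, update_markCells]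

end OracleMachine

/-! ### Invariants of the simulation and its single steps. -/

namespace OracleMachine

variable {A : Type} {M N : OracleMachine A}

/-- The two assignments of tapes agree as far as the outer machine is concerned. -/
structure SameOuter (S T : Role M.K N.K → CompTape M N) : Prop where
  outer : ∀ i, S (.outer i) = T (.outer i)
  queryHead : S .queryHead = T .queryHead
  answerHead : S .answerHead = T .answerHead

theorem SameOuter.refl (S : Role M.K N.K → CompTape M N) : SameOuter S S :=
  ⟨fun _ => rfl, rfl, rfl⟩

theorem SameOuter.trans {S T U : Role M.K N.K → CompTape M N} (h : SameOuter S T)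
    (h' : SameOuter T U) : SameOuter S U :=
  ⟨fun i => (h.outer i).trans (h'.outer i), h.queryHead.trans h'.queryHead,
    h.answerHead.trans h'.answerHead⟩

/-- The tapes represent the configuration `c` of the inner machine, at time at most `k`. -/
structure RepresentsInner (k : ℕ) (c : N.Cfg) (asked : Bool) (S : Role M.K N.K → CompTape M N) :
    Prop where
  tape : ∀ i, S (innerRole asked i) = (c.tapes i).map CompSymbol.inner
  bounded : ∀ i, (S (.inner i)).Bounded k
  oracle : (S .oracle).head ≤ k
  head : (S .oracle).head = (c.tapes .answer).head

/-- The tapes represent the configuration `c` of the outer machine, at time at most `k`. -/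
structure RepresentsOuter (k : ℕ) (c : M.Cfg) (S : Role M.K N.K → CompTape M N) : Prop where
  tape : ∀ i, S (.outer i) = (c.tapes i).map CompSymbol.outer
  queryHead : S .queryHead = ⟨fun _ => none, (c.tapes .query).head⟩
  answerHead : S .answerHead = ⟨fun _ => none, (c.tapes .answer).head⟩
  query : (c.tapes .query).Bounded k
  answer : (c.tapes .answer).Bounded k
  blank : ∀ i, (S (.inner i)).cells = fun _ => none
  head : ∀ i, (S (.inner i)).head ≤ k
  oracle : (S .oracle).head ≤ k

variable {φ : StringFunctions A}

theorem innerAction_innerRole (s : TapeName N.K → Cell A N.G × HeadMove) (asked : Bool)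
    (r : Role M.K N.K → CompCell M N) (i : TapeName N.K) :
    innerAction s asked r (innerRole asked i) =
      ((s i).1.map (Sum.map id CompSymbol.inner), (s i).2) := by
  cases asked <;> rcases i with _ | _ | _ | _ | i <;> rfl

theorem RepresentsInner.ordinaryStep {k : ℕ} {c : N.Cfg} {asked : Bool}
    {S : Role M.K N.K → CompTape M N} (h : RepresentsInner k c asked S)
    (h₁ : c.state ≠ N.halt) (h₂ : c.state ≠ N.ask) :
    ∃ S', Reaches φ 1 ⟨.inner c.state asked, clockTape k (k + 1), S⟩
        ⟨.inner (N.ordinaryStep c).state asked, clockTape (k + 1) (k + 2), S'⟩ ∧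
      RepresentsInner (k + 1) (N.ordinaryStep c) asked S' ∧ SameOuter S' S := by
  let s := N.trans c.state fun i => (c.tapes i).read
  let r := fun y => (S y).read
  have hr : (fun i => innerCell (r (innerRole asked i))) = fun i => (c.tapes i).read := by
    funext i
    simp only [r, h.tape, OTape.map_read, innerCell_map]
  have step := reaches_one (φ := φ) (M := M) (N := N) (q := .inner c.state asked)
    (c := clockTape k (k + 1)) (S := S) (q' := .inner s.1 asked)
    (d := (markCell, HeadMove.right)) (s := innerAction s.2 asked r) (by simp) (by simp)
    (by
      change compTrans M N _ _ r = _
      simp only [compTrans, if_neg h₁, if_neg h₂, hr]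
      rfl)
  rw [clockTape_tick_right] at step
  refine ⟨_, step, ⟨?_, ?_, ?_, ?_⟩, ⟨?_, ?_, ?_⟩⟩
  · intro i
    rw [innerAction_innerRole, h.tape]
    exact (OTape.map_writeMove _ _ _ _).symm
  · exact fun i => (h.bounded i).writeMove _ _
  · exact (OTape.head_writeMove_le _ _ _).trans (Nat.add_le_add_right h.oracle 1)
  -- The true answer tape makes the head moves of the simulated one even before the first call.
  · have := h.head
    simp only [innerAction, OTape.writeMove, OracleMachine.ordinaryStep, this]
    rfl
  · exact fun i => OTape.writeMove_read_stay _
  · exact OTape.writeMove_read_stay _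
  · exact OTape.writeMove_read_stay _

/-- The call replaces whatever the true answer tape carried and keeps its head, which is already
where the head of the simulated tape is. So the switch to the true tape is exact, whatever an
earlier run left there. -/
theorem RepresentsInner.oracleStep {k : ℕ} {c : N.Cfg} {asked : Bool}
    {S : Role M.K N.K → CompTape M N} (h : RepresentsInner k c asked S)
    (h₁ : c.state ≠ N.halt) (h₂ : c.state = N.ask) :
    ∃ S', Reaches φ 2 ⟨.inner c.state asked, clockTape k (k + 1), S⟩
        ⟨.inner (N.oracleStep φ c).state true, clockTape (k + 1) (k + 2), S'⟩ ∧
      RepresentsInner (k + 1) (N.oracleStep φ c) true S' ∧ SameOuter S' S := by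
  have step := reaches_one (φ := φ) (M := M) (N := N) (q := .inner c.state asked)
    (c := clockTape k (k + 1)) (S := S) (q' := .ask)
    (d := (markCell, HeadMove.right)) (s := idleAction fun y => (S y).read) (by simp) (by simp)
    (by simp only [compTrans, if_neg h₁, if_pos h₂])
  rw [clockTape_tick_right, writeMove_idle] at step
  refine ⟨_, step.trans reaches_ask, ⟨?_, ?_, ?_, ?_⟩, ⟨?_, ?_, ?_⟩⟩
  · have hq : (S (.inner .query)).content = (c.tapes .query).content :=
      (congrArg OTape.content (h.tape .query)).trans (OTape.map_content _ _)
    intro i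
    have hi := h.tape i
    rcases i with _ | _ | _ | _ | i <;> try exact hi
    change (S .oracle).replaceBy _ = ((c.tapes .answer).replaceBy _).map _
    rw [OTape.map_replaceBy, hq]
    simp only [OTape.replaceBy, h.head, OTape.map_head]
  · exact fun i => (h.bounded i).mono k.le_succ
  · exact h.oracle.trans k.le_succ
  · exact h.head
  · exact fun i => rfl
  · rfl
  · rfl

/-- The factor `2` arises because an oracle call needs one step to enter the oracle state and one to
call; the clock ticks only once. -/
theorem RepresentsInner.run {k : ℕ} {b : List A} {S : Role M.K N.K → CompTape M N}
    (h : RepresentsInner k (N.init b) false S) (t : ℕ) :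
    ∃ n l asked S', n ≤ 2 * t ∧ k ≤ l ∧ l ≤ k + t ∧
      Reaches φ n ⟨.inner N.start false, clockTape k (k + 1), S⟩
        ⟨.inner (N.run φ b t).state asked, clockTape l (l + 1), S'⟩ ∧
      RepresentsInner l (N.run φ b t) asked S' ∧ SameOuter S' S := by
  induction t with
  | zero => exact ⟨0, k, false, S, le_rfl, le_rfl, le_rfl, rfl, h, .refl S⟩
  | succ t ih =>
    obtain ⟨n, l, asked, S', hn, hkl, hl, hr, hS, hS'⟩ := ih
    rw [run_succ, step]
    split_ifs with h₁ h₂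
    · exact ⟨n, l, asked, S', by omega, hkl, by omega, hr, hS, hS'⟩
    · obtain ⟨T, hT, hT', hT''⟩ := hS.oracleStep (φ := φ) h₁ h₂
      exact ⟨_, l + 1, true, T, by omega, by omega, by omega, hr.trans hT, hT', hT''.trans hS'⟩
    · obtain ⟨T, hT, hT', hT''⟩ := hS.ordinaryStep (φ := φ) h₁ h₂
      exact ⟨_, l + 1, asked, T, by omega, by omega, by omega, hr.trans hT, hT', hT''.trans hS'⟩

theorem RepresentsOuter.ordinaryStep {k : ℕ} {c : M.Cfg}
    {S : Role M.K N.K → CompTape M N} (h : RepresentsOuter k c S)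
    (h₁ : c.state ≠ M.halt) (h₂ : c.state ≠ M.ask) :
    ∃ S', Reaches φ 1 ⟨.outer c.state, clockTape k (k + 1), S⟩
        ⟨.outer (M.ordinaryStep c).state, clockTape (k + 1) (k + 2), S'⟩ ∧
      RepresentsOuter (k + 1) (M.ordinaryStep c) S' := by
  let s := M.trans c.state fun i => (c.tapes i).read
  let r := fun y => (S y).read
  have hr : (fun i => outerCell (r (.outer i))) = fun i => (c.tapes i).read := by
    funext i
    simp only [r, h.tape, OTape.map_read, outerCell_map]
  have step := reaches_one (φ := φ) (M := M) (N := N) (q := .outer c.state)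
    (c := clockTape k (k + 1)) (S := S) (q' := .outer s.1)
    (d := (markCell, HeadMove.right)) (s := outerAction s.2 r) (by simpa using h₁) (by simp)
    (by
      change compTrans M N _ _ r = _
      simp only [compTrans, if_neg h₂, hr]
      rfl)
  rw [clockTape_tick_right] at step
  have blank (t : CompTape M N) (ht : t.cells = fun _ => none) (m : HeadMove) :
      (t.writeMove t.read m).cells = fun _ => none := by
    simp [OTape.writeMove, OTape.read, ht]
  refine ⟨_, step, ⟨?_, ?_, ?_, ?_, ?_, ?_, ?_, ?_⟩⟩
  · exact fun i => (congrArg (fun t => OTape.writeMove t _ _) (h.tape i)).trans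
      (OTape.map_writeMove _ _ _ _).symm
  -- The tape for the head mark stays blank and copies the head move of the query tape.
  · simp only [outerAction, r, OracleMachine.ordinaryStep, h.queryHead]
    simp [OTape.writeMove, OTape.read, s]
  · simp only [outerAction, r, OracleMachine.ordinaryStep, h.answerHead]
    simp [OTape.writeMove, OTape.read, s]
  · exact h.query.writeMove _ _
  · exact h.answer.writeMove _ _
  · exact fun i => blank _ (h.blank i) _
  · exact fun i => (OTape.head_writeMove_le _ _ _).trans (Nat.add_le_add_right (h.head i) 1)
  · exact (OTape.head_writeMove_le _ _ _).trans (Nat.add_le_add_right h.oracle 1)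

/-- The tapes after the heads of the outer machine have been marked. -/
def marked (S : Role M.K N.K → CompTape M N) : Role M.K N.K → CompTape M N
  | .queryHead => ⟨markCells (S .queryHead).head, (S .queryHead).head⟩
  | .answerHead => ⟨markCells (S .answerHead).head, (S .answerHead).head⟩
  | x => S x

theorem writeMove_mark (h : ℕ) :
    (⟨fun _ => none, h⟩ : CompTape M N).writeMove markCell HeadMove.stay = ⟨markCells h, h⟩ := by
  simp only [OTape.writeMove, OTape.mk.injEq, and_true]
  funext n
  by_cases hn : n = h <;> simp [hn, markCells]

theorem RepresentsOuter.reaches_marked {k : ℕ} {c : M.Cfg} {S : Role M.K N.K → CompTape M N}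
    (h : RepresentsOuter k c S) (h₁ : c.state ≠ M.halt) (h₂ : c.state = M.ask) :
    Reaches φ 1 ⟨.outer c.state, clockTape k (k + 1), S⟩
      ⟨.rewind .load, clockTape (k + 1) (k + 1), marked S⟩ := by
  have step := reaches_one (φ := φ) (M := M) (N := N) (q := .outer c.state)
    (c := clockTape k (k + 1)) (S := S) (q' := .rewind .load)
    (d := (markCell, HeadMove.stay)) (s := markAction fun y => (S y).read)
    (by simpa using h₁) (by simp) (by simp only [compTrans, if_pos h₂])
  rw [clockTape_tick_stay] at step
  convert step using 2
  funext x
  rcases x with _ | _ | _ | i | i <;> try exact (OTape.writeMove_read_stay _).symm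
  · simp [marked, markAction, h.queryHead, writeMove_mark]
  · simp [marked, markAction, h.answerHead, writeMove_mark]

end OracleMachine

/-! ### Answering a query of the outer machine. -/

namespace OracleMachine

variable {A : Type} {M N : OracleMachine A}

/-- The tapes represent the configuration `c` of the outer machine, which is waiting for an
answer. -/
structure Suspended (c : M.Cfg) (S : Role M.K N.K → CompTape M N) : Prop where
  tape : ∀ i, i ≠ .query → i ≠ .answer → S (.outer i) = (c.tapes i).map CompSymbol.outer
  query : S (.outer .query) = ⟨((c.tapes .query).map CompSymbol.outer).cells, 0⟩
  answer : S (.outer .answer) = ⟨fun _ => none, 0⟩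
  queryHead : S .queryHead = ⟨markCells (c.tapes .query).head, 0⟩
  answerHead : S .answerHead = ⟨markCells (c.tapes .answer).head, 0⟩

theorem Suspended.congr {c : M.Cfg} {S T : Role M.K N.K → CompTape M N} (h : Suspended c S)
    (hT : SameOuter T S) : Suspended c T where
  tape i h₁ h₂ := (hT.outer i).trans (h.tape i h₁ h₂)
  query := (hT.outer _).trans h.query
  answer := (hT.outer _).trans h.answer
  queryHead := hT.queryHead.trans h.queryHead
  answerHead := hT.answerHead.trans h.answerHead

theorem not_mobile_outer {i : TapeName M.K} (h₁ : i ≠ .query) (h₂ : i ≠ .answer) :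
    ¬ (Role.outer i : Role M.K N.K).Mobile := by
  cases i <;> simp_all [Role.Mobile]

theorem rewound_outer {k : ℕ} {S : Role M.K N.K → CompTape M N} {i : TapeName M.K}
    (h₁ : i ≠ .query) (h₂ : i ≠ .answer) : rewound k S (.outer i) = S (.outer i) :=
  rewound_of_not_mobile (not_mobile_outer h₁ h₂)

theorem rewound_of_eq {k : ℕ} {S : Role M.K N.K → CompTape M N} {x : Role M.K N.K}
    {c : ℕ → CompCell M N} {h : ℕ} (hx : x.Mobile) (hS : S x = ⟨c, h⟩) (hk : h ≤ k) :
    rewound k S x = ⟨c, 0⟩ := by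
  rw [rewound_of_mobile hx (by rw [hS]; exact hk), hS]

theorem prefixTape_wordLength (t : CompTape M N) :
    prefixTape t.cells t.wordLength = ⟨OTape.cellsOfWord t.content, t.wordLength⟩ := by
  simp only [prefixTape, OTape.mk.injEq, and_true]
  exact funext fun n => (OTape.cellsOfWord_content t n).symm

variable {φ : StringFunctions A}

/-- One step marks the heads and raises the clock to `k + 1`; then two rewinds and two sweeps, each
of `k + 2` steps, load the query, erase the old answer and bring the inner heads to cell `0`. -/
theorem RepresentsOuter.reaches_suspended {k : ℕ} {c : M.Cfg} {S : Role M.K N.K → CompTape M N}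
    (h : RepresentsOuter k c S) (h₁ : c.state ≠ M.halt) (h₂ : c.state = M.ask) :
    ∃ S', Reaches φ (1 + (k + 2) + (k + 2) + (k + 2) + (k + 2))
        ⟨.outer c.state, clockTape k (k + 1), S⟩
        ⟨.inner N.start false, clockTape (k + 1) (k + 2), S'⟩ ∧
      RepresentsInner (k + 1) (N.init (c.tapes .query).content) false S' ∧ Suspended c S' := by
  set t : CompTape M N := (c.tapes .query).map CompSymbol.outer
  have htb : t.Bounded (k + 1) := (h.query.map _).mono k.le_succ
  have htw : t.wordLength ≤ k + 1 := htb.wordLength_le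
  have htc : t.content = (c.tapes .query).content := OTape.map_content _ _
  set S₂ := rewound (k + 1) (marked S) with hS₂
  have q₂ : S₂ (.outer .query) = ⟨t.cells, 0⟩ :=
    rewound_of_eq trivial (h.tape .query) htb.1
  have a₂ : S₂ (.outer .answer) = ⟨((c.tapes .answer).map CompSymbol.outer).cells, 0⟩ :=
    rewound_of_eq trivial (h.tape .answer) (h.answer.1.trans k.le_succ)
  have i₂ (i) : S₂ (.inner i) = ⟨fun _ => none, 0⟩ :=
    (rewound_of_mobile (S := marked S) (x := .inner i) trivial
      ((h.head i).trans k.le_succ)).trans (congrArg (OTape.mk · 0) (h.blank i))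
  have qh₂ : S₂ .queryHead = ⟨markCells (c.tapes .query).head, 0⟩ :=
    rewound_of_eq (h := (c.tapes .query).head) trivial (by simp [marked, h.queryHead]) htb.1
  have ah₂ : S₂ .answerHead = ⟨markCells (c.tapes .answer).head, 0⟩ :=
    rewound_of_eq (h := (c.tapes .answer).head) trivial (by simp [marked, h.answerHead])
      (h.answer.1.trans k.le_succ)
  have o₂ : (S₂ .oracle).head = 0 :=
    congrArg OTape.head (rewound_of_mobile (S := marked S) (x := .oracle) trivial
      (h.oracle.trans k.le_succ))
  have hw : (S₂ (.outer .query)).wordLength = t.wordLength := by rw [q₂]; rfl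
  set S₃ := loaded S₂ (k + 1) with hS₃
  have q₃ : S₃ (.outer .query) = ⟨t.cells, t.wordLength⟩ := by
    change (⟨(S₂ (.outer .query)).cells, min (k + 1) _⟩ : CompTape M N) = _
    rw [hw, min_eq_right htw, q₂]
  have a₃ : S₃ (.outer .answer) = ⟨fun _ => none, k + 1⟩ := by
    simp only [hS₃, loaded, a₂]
    exact erasedTape_of_blank ((h.answer.map _).mono k.le_succ).2
  have i₃ : S₃ (.inner .input) =
      ⟨OTape.cellsOfWord (c.tapes .query).content, t.wordLength⟩ := by
    change prefixTape (S₂ (.outer .query)).cells (min (k + 1) _) = _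
    rw [hw, min_eq_right htw, q₂, ← htc]
    exact prefixTape_wordLength t
  have i₄ : rewound (k + 1) S₃ (.inner .input) = OTape.ofWord (c.tapes .query).content :=
    rewound_of_eq trivial i₃ htw
  have i₄' (i) (hi : i ≠ .input) : rewound (k + 1) S₃ (.inner i) = OTape.ofWord [] := by
    refine rewound_of_eq (h := 0) trivial ?_ (Nat.zero_le _)
    refine Eq.trans ?_ (i₂ i)
    cases i <;> first | rfl | exact absurd rfl hi
  have hbl : (c.tapes .query).content.length ≤ k + 1 := by
    rw [← htc]; exact (OTape.length_content_le t).trans htw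
  have o₄ : (rewound (k + 1) S₃ .oracle).head = 0 := by
    rw [rewound_of_mobile (x := .oracle) trivial]; exact o₂.le.trans (Nat.zero_le _)
  refine ⟨rewound (k + 1) S₃, ((((h.reaches_marked h₁ h₂).trans (reaches_rewind _ _ _)).trans
    (reaches_load (l := k + 1) ?_ ?_ ?_ (i₂ .input))).trans (reaches_rewind _ _ _)).trans
      reaches_reset, ⟨?_, ?_, ?_, ?_⟩, ⟨?_, ?_, ?_, ?_, ?_⟩⟩
  · exact congrArg OTape.head q₂
  · change (S₂ (.outer .query)).Bounded (k + 1)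
    rw [q₂]; exact ⟨Nat.zero_le _, htb.2⟩
  · exact congrArg OTape.head a₂
  · intro i
    rcases i with _ | _ | _ | _ | i
    · exact i₄.trans (OTape.map_ofWord _ _).symm
    all_goals exact (i₄' _ (by simp)).trans (OTape.map_ofWord _ _).symm
  · intro i
    by_cases hi : i = .input
    · rw [hi, i₄]; exact OTape.bounded_ofWord hbl
    · rw [i₄' i hi]; exact OTape.bounded_ofWord (Nat.zero_le _)
  · rw [o₄]; exact Nat.zero_le _
  · rw [o₄]; rfl
  · intro i hi hi'
    rw [rewound_outer hi hi', ← h.tape i]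
    have : S₃ (.outer i) = S₂ (.outer i) := by cases i <;> simp_all [loaded]
    rw [this, hS₂, rewound_outer hi hi']; rfl
  · exact rewound_of_eq trivial q₃ htw
  · exact rewound_of_eq trivial a₃ le_rfl
  · exact rewound_of_eq trivial qh₂ (Nat.zero_le _)
  · exact rewound_of_eq trivial ah₂ (Nat.zero_le _)

/-- The answer lies on the output tape of the inner machine, which the clock bounds. Hence it can be
copied within one sweep, and the answer tape of the outer machine stays bounded by the clock. -/
theorem Suspended.reaches_resume {k : ℕ} {c : M.Cfg} {d : N.Cfg} {asked : Bool}
    {S : Role M.K N.K → CompTape M N} (h : Suspended c S) (hd : RepresentsInner k d asked S)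
    (hdh : d.state = N.halt) (hq : (c.tapes .query).Bounded k)
    (ha : (c.tapes .answer).head ≤ k) {ψ : StringFunctions A}
    (hψ : (d.tapes .output).content = ψ (c.tapes .query).content) :
    ∃ S', Reaches φ (1 + (k + 1) + (k + 1) + (k + 1) + (k + 1))
        ⟨.inner d.state asked, clockTape k (k + 1), S⟩
        ⟨.outer M.resume, clockTape k (k + 1), S'⟩ ∧
      RepresentsOuter k (M.oracleStep ψ c) S' := by
  have step := reaches_one (φ := φ) (M := M) (N := N) (q := .inner d.state asked)
    (c := clockTape k (k + 1)) (S := S) (q' := .rewind .unload)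
    (d := ((clockTape k (k + 1)).read, HeadMove.left)) (s := idleAction fun y => (S y).read)
    (by simp) (by simp) (by simp only [compTrans, if_pos hdh])
  rw [clockTape_left, writeMove_idle] at step
  set b := (c.tapes .query).content
  set t : CompTape M N := S (.inner .output)
  have htb : t.Bounded k := hd.bounded .output
  have htw : t.wordLength ≤ k := htb.wordLength_le
  have htc : t.content = ψ b := by
    rw [← hψ]
    exact (congrArg OTape.content (hd.tape .output)).trans (OTape.map_content _ _)
  have hψl : (ψ b).length ≤ k := by
    rw [← htc]; exact (OTape.length_content_le t).trans htw
  set S₂ := rewound k S with hS₂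
  have a₂ : S₂ (.outer .answer) = ⟨fun _ => none, 0⟩ :=
    rewound_of_eq trivial h.answer (Nat.zero_le _)
  have i₂ (i) : S₂ (.inner i) = ⟨(S (.inner i)).cells, 0⟩ :=
    rewound_of_mobile trivial (hd.bounded i).1
  have hw : (S₂ (.inner .output)).wordLength = t.wordLength := by rw [i₂]; rfl
  set S₃ := unloaded S₂ k with hS₃
  have a₃ : S₃ (.outer .answer) = ⟨OTape.cellsOfWord (ψ b), t.wordLength⟩ := by
    change prefixTape (S₂ (.inner .output)).cells (min k _) = _
    rw [hw, min_eq_right htw, i₂, ← htc]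
    exact prefixTape_wordLength t
  have i₃ (i) : (S₃ (.inner i)).cells = (S (.inner i)).cells ∧ (S₃ (.inner i)).head ≤ k := by
    have := i₂ i
    cases i <;> simp_all [unloaded]
  set S₄ := rewound k S₃ with hS₄
  have q₄ : S₄ (.outer .query) = ⟨((c.tapes .query).map CompSymbol.outer).cells, 0⟩ :=
    rewound_of_eq (h := 0) trivial (rewound_of_eq trivial h.query (Nat.zero_le _)) (Nat.zero_le _)
  have a₄ : S₄ (.outer .answer) = ⟨OTape.cellsOfWord (ψ b), 0⟩ :=
    rewound_of_eq trivial a₃ htw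
  have i₄ (i) : S₄ (.inner i) = ⟨(S (.inner i)).cells, 0⟩ := by
    rw [hS₄, rewound_of_mobile (x := .inner i) trivial (i₃ i).2, (i₃ i).1]
  have qh₄ : S₄ .queryHead = ⟨markCells (c.tapes .query).head, 0⟩ :=
    rewound_of_eq (h := 0) trivial (rewound_of_eq trivial h.queryHead (Nat.zero_le _))
      (Nat.zero_le _)
  have ah₄ : S₄ .answerHead = ⟨markCells (c.tapes .answer).head, 0⟩ :=
    rewound_of_eq (h := 0) trivial (rewound_of_eq trivial h.answerHead (Nat.zero_le _))
      (Nat.zero_le _)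
  -- Only the head is controlled: the word left by the last oracle call may extend beyond the clock
  -- and is kept.
  have o₄ : (S₄ .oracle).head ≤ k := by
    have h2 : S₂ .oracle = ⟨(S .oracle).cells, 0⟩ := rewound_of_mobile trivial hd.oracle
    have h4 : S₄ .oracle = ⟨(S .oracle).cells, 0⟩ :=
      rewound_of_eq (h := 0) trivial h2 (Nat.zero_le _)
    rw [h4]; exact Nat.zero_le _
  -- All inner tapes, including the separate answer tape, are blank from cell `k` on, so erasing `k`
  -- cells clears them for the next query.
  have e₅ (i) : unmarked S₄ (c.tapes .query).head (c.tapes .answer).head k (.inner i) =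
      ⟨fun _ => none, k⟩ := by
    simp only [unmarked, restored, i₄]
    exact erasedTape_of_blank (hd.bounded i).2
  refine ⟨_, (((step.trans (reaches_rewind _ _ _)).trans
    (reaches_unload (l := k) ?_ ?_ a₂)).trans (reaches_rewind _ _ _)).trans
      (reaches_restore hq.1 ha qh₄ ah₄ ?_ ?_ ?_), ⟨?_, ?_, ?_, ?_, ?_, ?_, ?_, ?_⟩⟩
  · exact congrArg OTape.head (i₂ .output)
  · change (S₂ (.inner .output)).Bounded k
    rw [i₂]; exact ⟨Nat.zero_le _, htb.2⟩
  · exact congrArg OTape.head q₄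
  · exact congrArg OTape.head a₄
  · exact fun i => congrArg OTape.head (i₄ i)
  · intro i
    by_cases hi : i = .query
    · subst hi
      change (⟨(S₄ (.outer .query)).cells, min k _⟩ : CompTape M N) = _
      rw [q₄, min_eq_right hq.1]; rfl
    by_cases hi' : i = .answer
    · subst hi'
      change (⟨(S₄ (.outer .answer)).cells, min k _⟩ : CompTape M N) =
        ((c.tapes .answer).replaceBy (ψ b)).map _
      rw [a₄, min_eq_right ha, OTape.map_replaceBy]; rfl
    have h1 : unmarked S₄ (c.tapes .query).head (c.tapes .answer).head k (.outer i) =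
        S₄ (.outer i) := by
      cases i <;> simp_all [unmarked, restored]
    have h2 : S₃ (.outer i) = S₂ (.outer i) := by cases i <;> simp_all [unloaded]
    have h3 : (M.oracleStep ψ c).tapes i = c.tapes i := by
      cases i <;> simp_all [OracleMachine.oracleStep]
    rw [h1, h3, hS₄, rewound_outer hi hi', h2, hS₂, rewound_outer hi hi', h.tape i hi hi']
  · rfl
  · rfl
  · exact hq
  · exact ⟨ha, (OTape.bounded_ofWord hψl).2⟩
  · exact fun i => congrArg OTape.cells (e₅ i)
  · exact fun i => (congrArg OTape.head (e₅ i)).le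
  · exact o₄

theorem RepresentsOuter.oracleStep {k : ℕ} {c : M.Cfg} {S : Role M.K N.K → CompTape M N}
    (h : RepresentsOuter k c S) (h₁ : c.state ≠ M.halt) (h₂ : c.state = M.ask)
    {ψ : StringFunctions A} (hψ : ψ ∈ N.operator φ) {t : ℕ}
    (ht : N.HaltedAt φ (c.tapes .query).content t) :
    ∃ n l S', n ≤ 18 * (k + t + 1) ∧ l ≤ k + t + 1 ∧
      Reaches φ n ⟨.outer c.state, clockTape k (k + 1), S⟩
        ⟨.outer (M.oracleStep ψ c).state, clockTape l (l + 1), S'⟩ ∧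
      RepresentsOuter l (M.oracleStep ψ c) S' := by
  obtain ⟨S₁, hr₁, hi, hs⟩ := h.reaches_suspended (φ := φ) h₁ h₂
  obtain ⟨n, l, asked, S₂, hn, hkl, hl, hr₂, hi', ho⟩ := hi.run (φ := φ) t
  obtain ⟨S₃, hr₃, h₃⟩ := (hs.congr ho).reaches_resume (φ := φ) hi' ht
    (h.query.mono (by omega)) (h.answer.1.trans (by omega))
    (N.output_content_of_haltedAt hψ ht)
  -- The total is at most `(4k + 9) + 2t + (4l + 5)` with `l ≤ k + t + 1`, that is, `8k + 6t + 18`.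
  exact ⟨_, l, S₃, by omega, by omega, (hr₁.trans hr₂).trans hr₃, h₃⟩

/-! ### Running time and value of the composite machine. -/

theorem representsOuter_init (a : List A) :
    RepresentsOuter 0 (M.init a) (view ((M.comp N).init a)).tapes where
  tape i := by
    rcases i with _ | _ | _ | _ | i <;> exact (OTape.map_ofWord _ _).symm
  queryHead := rfl
  answerHead := rfl
  query := OTape.bounded_ofWord le_rfl
  answer := OTape.bounded_ofWord le_rfl
  blank i := by rcases i with _ | _ | _ | _ | i <;> rfl
  head i := by rcases i with _ | _ | _ | _ | i <;> exact le_rfl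
  oracle := le_rfl

/-- Each outer step raises the clock by at most `B + 1`, so the clock never exceeds `t * (B + 1)`
before a step, and this bounds the cost of answering any query. -/
theorem reaches_run {ψ : StringFunctions A} (hψ : ψ ∈ N.operator φ) {a : List A} {t B : ℕ}
    (hB : ∀ b : List A, b.length ≤ t → N.HaltedAt φ b B) (s : ℕ) (hs : s ≤ t) :
    ∃ n k S, n ≤ 1 + s * (18 * (t * (B + 1) + B + 1)) ∧ k ≤ s * (B + 1) ∧
      Reaches φ n (view ((M.comp N).init a))
        ⟨.outer (M.run ψ a s).state, clockTape k (k + 1), S⟩ ∧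
      RepresentsOuter k (M.run ψ a s) S := by
  induction s with
  | zero =>
    have h := reaches_one (φ := φ) (M := M) (N := N) (q := .init)
      (c := OTape.ofWord []) (S := (view ((M.comp N).init a)).tapes)
      (q' := .outer M.start) (d := (bottomCell, HeadMove.right))
      (s := idleAction fun y => ((view ((M.comp N).init a)).tapes y).read)
      (by simp) (by simp) rfl
    rw [clockTape_init, writeMove_idle] at h
    exact ⟨1, 0, _, by omega, by omega, h, representsOuter_init a⟩
  | succ s ih =>
    obtain ⟨n, k, S, hn, hk, hr, hS⟩ := ih (by omega)
    have hk' : k ≤ t * (B + 1) := hk.trans (Nat.mul_le_mul_right _ (by omega))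
    have e₁ : (s + 1) * (18 * (t * (B + 1) + B + 1)) =
      s * (18 * (t * (B + 1) + B + 1)) + 18 * (t * (B + 1) + B + 1) := Nat.succ_mul _ _
    have e₂ : (s + 1) * (B + 1) = s * (B + 1) + (B + 1) := Nat.succ_mul _ _
    rw [run_succ, e₁, e₂]
    unfold step
    split_ifs with h₁ h₂
    · exact ⟨n, k, S, by omega, by omega, hr, hS⟩
    · have hlen : ((M.run ψ a s).tapes .query).content.length ≤ t :=
        (OTape.length_content_le _).trans ((M.bounded_run ψ a s).wordLength_le.trans (by omega))
      obtain ⟨m, l, S', hm, hl, hr', hS'⟩ := hS.oracleStep (φ := φ) h₁ h₂ hψ (hB _ hlen)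
      exact ⟨_, l, S', by omega, by omega, hr.trans hr', hS'⟩
    · obtain ⟨S', hr', hS'⟩ := hS.ordinaryStep (φ := φ) h₁ h₂
      exact ⟨_, k + 1, S', by omega, by omega, hr.trans hr', hS'⟩

theorem comp_haltedAt {ψ : StringFunctions A} (hψ : ψ ∈ N.operator φ) {a : List A} {t B : ℕ}
    (hB : ∀ b : List A, b.length ≤ t → N.HaltedAt φ b B) (ht : M.HaltedAt ψ a t) :
    (M.comp N).HaltedAt φ a (1 + t * (18 * (t * (B + 1) + B + 1))) ∧
      ((M.run ψ a t).tapes .output).content ∈ (M.comp N).eval φ a := by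
  obtain ⟨n, k, S, hn, -, hr, hS⟩ := reaches_run (M := M) hψ hB t le_rfl
  have hv : view ((M.comp N).run φ a n) = _ := view_iterate hr
  have hh : (M.comp N).HaltedAt φ a n := by
    have h := congrArg View.state hv
    rw [HaltedAt] at ht
    rw [ht] at h
    exact h
  refine ⟨hh.mono hn, (M.comp N).mem_eval_iff.2 ⟨n, hh, ?_⟩⟩
  have h := congrFun (congrArg View.tapes hv) (.outer .output)
  exact (congrArg OTape.content (h.trans (hS.tape .output))).trans (OTape.map_content _ _)

theorem mem_operator_comp {ψ χ : StringFunctions A} (hψ : ψ ∈ N.operator φ)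
    (hχ : χ ∈ M.operator ψ) (hB : ∀ n, ∃ B, ∀ b : List A, b.length ≤ n → N.HaltedAt φ b B) :
    χ ∈ (M.comp N).operator φ := by
  rw [mem_operator_iff]
  intro a
  obtain ⟨t, ht, h⟩ := M.mem_eval_iff.1 (M.mem_operator_iff.1 hχ a)
  obtain ⟨B, hB⟩ := hB t
  rw [← h]
  exact (comp_haltedAt hψ hB ht).2

end OracleMachine

/-! ### Substitution and monotonicity for second-order polynomials. -/

namespace IsSecondOrderPolynomial

variable {P Q : (ℕ → ℕ) → ℕ → ℕ}

theorem const (m : ℕ) : IsSecondOrderPolynomial fun _ _ => m := by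
  simpa using poly (Polynomial.C m)

theorem pow (hP : IsSecondOrderPolynomial P) (m : ℕ) :
    IsSecondOrderPolynomial fun l n => P l n ^ m := by
  induction m with
  | zero => simpa using const 1
  | succ m ih => simpa only [pow_succ] using ih.mul hP

theorem comp_right (hP : IsSecondOrderPolynomial P) (hQ : IsSecondOrderPolynomial Q) :
    IsSecondOrderPolynomial fun l n => P l (Q l n) := by
  induction hP with
  | poly p =>
    induction p using Polynomial.induction_on' with
    | add p q hp hq => simpa only [Polynomial.eval_add] using hp.add hq
    | monomial m c => simpa only [Polynomial.eval_monomial] using (const c).mul (hQ.pow m)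
  | app _ ih => exact ih.app
  | add _ _ ih ih' => exact ih.add ih'
  | mul _ _ ih ih' => exact ih.mul ih'

/-- An application of `l` turns into `Q l` evaluated at a second-order polynomial, which is where
substitution in the number argument enters. -/
theorem comp_left (hP : IsSecondOrderPolynomial P) (hQ : IsSecondOrderPolynomial Q) :
    IsSecondOrderPolynomial fun l n => P (Q l) n := by
  induction hP with
  | poly p => exact poly p
  | app _ ih => exact hQ.comp_right ih
  | add _ _ ih ih' => exact ih.add ih'
  | mul _ _ ih ih' => exact ih.mul ih'

/-- In an application, the argument is enlarged first and the function afterwards; so only the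
smaller function has to be monotone. -/
theorem apply_mono (hP : IsSecondOrderPolynomial P) {l l' : ℕ → ℕ} (hl : Monotone l)
    (hll' : l ≤ l') {m n : ℕ} (hmn : m ≤ n) : P l m ≤ P l' n := by
  induction hP with
  | poly p =>
    induction p using Polynomial.induction_on' with
    | add p q hp hq => simpa only [Polynomial.eval_add] using add_le_add hp hq
    | monomial m c =>
      simp only [Polynomial.eval_monomial]
      gcongr
  | app _ ih => exact (hl ih).trans (hll' _)
  | add _ _ ih ih' => exact add_le_add ih ih'
  | mul _ _ ih ih' => exact Nat.mul_le_mul ih ih'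

end IsSecondOrderPolynomial

/-! ### Composition of polynomial-time computable functions. -/

namespace PreparametrisedSpace

variable {A : Type} {X Y Z : Type*}

theorem monotone_μ (SX : PreparametrisedSpace A X) (φ : SX.ξ.Dom) : Monotone (SX.μ φ) :=
  monotone_nat_of_le_succ (SX.monotone φ)

theorem PolytimeComputable.comp {SX : PreparametrisedSpace A X} {SY : PreparametrisedSpace A Y}
    {SZ : PreparametrisedSpace A Z} {f : X → Y} {g : Y → Z} (hg : SY.PolytimeComputable SZ g)
    (hf : SX.PolytimeComputable SY f) : SX.PolytimeComputable SZ (g ∘ f) := by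
  obtain ⟨N, PN, QN, hPN, hQN, hfN, htN, hμN⟩ := hf
  obtain ⟨M, PM, QM, hPM, hQM, hgM, htM, hμM⟩ := hg
  have hPt : IsSecondOrderPolynomial fun l n => PM (QN l) n := hPM.comp_left hQN
  have hPB : IsSecondOrderPolynomial fun l n => PN l (PM (QN l) n) := hPN.comp_right hPt
  -- Names of the intermediate and final values; the parameter bounds need them as elements of the
  -- domains of the representations.
  have key (φ : SX.ξ.Dom) : ∃ (ψ : SY.ξ.Dom) (χ : SZ.ξ.Dom), ψ.1 ∈ N.operator φ.1 ∧
      χ.1 ∈ M.operator ψ.1 ∧ χ.1 ∈ (M.comp N).operator φ.1 ∧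
      ∀ x ∈ SX.ξ φ.1, g (f x) ∈ SZ.ξ χ.1 := by
    obtain ⟨φ, hφ⟩ := φ
    obtain ⟨x, hx⟩ := Part.dom_iff_mem.1 hφ
    obtain ⟨ψ, hψ, hfx⟩ := hfN φ x hx
    obtain ⟨χ, hχ, hgx⟩ := hgM ψ (f x) hfx
    refine ⟨⟨ψ, Part.dom_iff_mem.2 ⟨_, hfx⟩⟩, ⟨χ, Part.dom_iff_mem.2 ⟨_, hgx⟩⟩, hψ, hχ,
      OracleMachine.mem_operator_comp hψ hχ fun n => ⟨PN (SX.μ ⟨φ, hφ⟩) n, fun b hb => ?_⟩, ?_⟩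
    · exact (N.haltedAt_of_time_le (htN ⟨φ, hφ⟩ b)).mono
        (hPN.apply_mono (SX.monotone_μ _) le_rfl hb)
    · intro x' hx'
      rwa [Part.mem_unique hx' hx]
  -- This is the bound of `comp_haltedAt` with `t = PM (QN l) n` and `B = PN l t`.
  refine ⟨M.comp N, fun l n => 1 + PM (QN l) n *
      (18 * (PM (QN l) n * (PN l (PM (QN l) n) + 1) + PN l (PM (QN l) n) + 1)),
    fun l n => QM (QN l) n, ?_, hQM.comp_left hQN, ?_, ?_, ?_⟩
  · have h1 := IsSecondOrderPolynomial.const 1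
    exact h1.add (hPt.mul ((IsSecondOrderPolynomial.const 18).mul
      (((hPt.mul (hPB.add h1)).add hPB).add h1)))
  · intro φ x hx
    obtain ⟨ψ, χ, -, -, hχ, h⟩ := key ⟨φ, Part.dom_iff_mem.2 ⟨x, hx⟩⟩
    exact ⟨χ.1, hχ, h x hx⟩
  · intro φ a
    obtain ⟨ψ, χ, hψ, hχ, -, -⟩ := key φ
    have ht : M.HaltedAt ψ.1 a (PM (QN (SX.μ φ)) a.length) :=
      (M.haltedAt_of_time_le (htM ψ a)).mono
        (hPM.apply_mono (SY.monotone_μ ψ) (hμN φ ψ hψ) le_rfl)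
    exact (M.comp N).time_le_of_haltedAt (OracleMachine.comp_haltedAt hψ (fun b hb =>
      (N.haltedAt_of_time_le (htN φ b)).mono (hPN.apply_mono (SX.monotone_μ _) le_rfl hb)) ht).1
  · intro φ χ' hχ' n
    obtain ⟨ψ, χ, hψ, hχ, hc, -⟩ := key φ
    -- The composite operator is single-valued, so its value is the one that `M` computes from `ψ`,
    -- and the parameter bound for `M` applies.
    have hχM : χ'.1 ∈ M.operator ψ.1 := by rwa [Part.mem_unique hχ' hc]
    exact (hμM ψ χ' hχM n).trans
      (hQM.apply_mono (SY.monotone_μ ψ) (hμN φ ψ hψ) le_rfl)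

end PreparametrisedSpace

theorem mainTheorem3 {A : Type} [Finite A] [Nonempty A] {X Y Z : Type*}
    (SX : PreparametrisedSpace A X) (SY : PreparametrisedSpace A Y) (SZ : PreparametrisedSpace A Z)
    (hX : SX.IsParametrised) (hY : SY.IsParametrised) (hZ : SZ.IsParametrised)
    (f : X → Y) (g : Y → Z)
    (hf : SX.PolytimeComputable SY f) (hg : SY.PolytimeComputable SZ g) :
    SX.PolytimeComputable SZ (g ∘ f) :=
  hg.comp hf
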